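/- Let $A=\bigoplus_{i\in I}B(H_i)$ (algebraic direct sum, $H_i\neq0$ finite-dimensional Hilbert spaces) with multiplier algebras $M(A)=\prod_iB(H_i)$, $M(A\otimes A)=\prod_{i,j}B(H_i)\otimes B(H_j)$. Suppose that $A$ is a discrete Hopf $*$-algebra: there is a coassociative nondegenerate $*$-homomorphism $\Delta\colon A\to M(A\otimes A)$ (nondegenerate: $\Delta(A)(A\otimes A)=A\otimes A$), with a counit $\varepsilon$ (a nonzero character of $A$ with $(\varepsilon\otimes\iota)\Delta=\iota=(\iota\otimes\varepsilon)\Delta$) and an antipode $S$ (an anti-automorphism with $m(S\otimes\iota)\Delta(a)=\varepsilon(a)1=m(\iota\otimes S)\Delta(a)$); these maps are extended to the multiplier algebras. Suppose that $A$ is quasitriangular with $R$-matrix $R$: $R\in M(A\otimes A)$ is invertible and $$\Delta^{op}=R\,\Delta(\cdot)R^{-1},\quad (\Delta\otimes\iota)(R)=R_{13}R_{23},\quad (\iota\otimes\Delta)(R)=R_{13}R_{12},\quad R^*=R_{21}.$$ Let $\hat A=\bigoplus_iB(H_i)^*\subset M(A)^*$, and let $U_R\subset M(A)$ be the linear span of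 the elements $(\omega\otimes\iota)(R)\,(\iota\otimes\eta)(R)$, $\omega,\eta\in\hat A$. Then there exists a discrete Hopf $*$-subalgebra $B\subset M(A)$ (that is, a $*$-subalgebra that is $*$-isomorphic to a direct sum of full matrix algebras and to which $\Delta$, $\varepsilon$ and $S$ restrict, as a nondegenerate $*$-homomorphism $B\to M(B\otimes B)$, a nonzero character, and a bijection $S(B)=B$), sitting in $M(A)$ nondegenerately, i.e. $BA=A$, such that: 1. $R\in M(B\otimes B)$; 2. $U_R$ is a Hopf $*$-subalgebra of $M(B)$: it is a unital $*$-subalgebra of $M(A)$ contained in $M(B)$, with $\Delta(U_R)\subset U_R\otimes U_R$ (algebraic tensor product) and $S(U_R)=U_R$; 3. $U_R$ is dense in $M(B)$ in the topology $\sigma(M(A),\hat A)$. Here, for nondegenerate $B$, $M(B)$ and $M(B\otimes B)$ are regarded as subalgebras of $M(A)$ and $M(A\otimes A)$. -/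

import Mathlib

open scoped Kronecker

universe u

namespace DiscreteHopf

section Blocks

variable {J : Type u}

/-- The full product `∏ⱼ B(Hⱼ)` of the matrix algebras with (finite) index types `n j`. It is the
multiplier algebra of the direct sum `⨁ⱼ B(Hⱼ)`. -/
abbrev Blocks (n : J → Type) : Type u := ∀ j, Matrix (n j) (n j) ℂ

/-- The direct sum `⨁ⱼ B(Hⱼ)`, as the `*`-subalgebra of finitely supported elements of the
product `∏ⱼ B(Hⱼ)`. -/
def finSupp (n : J → Type) [∀ j, Fintype (n j)] : NonUnitalStarSubalgebra ℂ (Blocks n) where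
  carrier := {x | {j | x j ≠ 0}.Finite}
  add_mem' {x y} hx hy := (Set.Finite.union hx hy).subset fun j hj => by
    by_contra h
    simp only [Set.mem_union, Set.mem_ofPred_eq, not_or, not_not] at h
    exact hj (by simp [h.1, h.2])
  zero_mem' := by simp
  mul_mem' {x y} hx _ := Set.Finite.subset hx fun j hj h0 => hj (by simp [h0])
  smul_mem' c x hx := Set.Finite.subset hx fun j hj h0 => hj (by simp [h0])
  star_mem' {x} hx := Set.Finite.subset hx fun j hj h0 => hj (by simp [h0])

end Blocks

variable {I : Type u}

/-- `M(A) = ∏ᵢ B(Hᵢ)` for `A = ⨁ᵢ B(Hᵢ)`, `dim Hᵢ = d i`. -/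
abbrev M (d : I → ℕ) : Type u := Blocks fun i => Fin (d i)

/-- `M(A ⊗ A) = ∏ᵢⱼ B(Hᵢ) ⊗ B(Hⱼ)`. -/
abbrev M₂ (d : I → ℕ) : Type u := Blocks fun p : I × I => Fin (d p.1) × Fin (d p.2)

/-- `M(A ⊗ A ⊗ A) = ∏ᵢⱼₖ B(Hᵢ) ⊗ B(Hⱼ) ⊗ B(Hₖ)`. -/
abbrev M₃ (d : I → ℕ) : Type u :=
  Blocks fun p : I × I × I => Fin (d p.1) × Fin (d p.2.1) × Fin (d p.2.2)

/-- The algebra `A = ⨁ᵢ B(Hᵢ)` inside `M(A)`. -/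
abbrev alg (d : I → ℕ) : NonUnitalStarSubalgebra ℂ (M d) := finSupp fun i => Fin (d i)

/-- The algebra `A ⊗ A = ⨁ᵢⱼ B(Hᵢ) ⊗ B(Hⱼ)` inside `M(A ⊗ A)`. -/
abbrev alg₂ (d : I → ℕ) : NonUnitalStarSubalgebra ℂ (M₂ d) :=
  finSupp fun p : I × I => Fin (d p.1) × Fin (d p.2)

/-- The dual `Â = ⨁ᵢ B(Hᵢ)* ⊆ M(A)*`: the linear functionals on `M(A)` that only depend on
finitely many blocks. -/
def dual (d : I → ℕ) : Submodule ℂ (Module.Dual ℂ (M d)) where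
  carrier := {ω | ∃ F : Finset I, ∀ x : M d, (∀ i ∈ F, x i = 0) → ω x = 0}
  add_mem' := by
    classical
    rintro ω η ⟨F, hF⟩ ⟨G, hG⟩
    refine ⟨F ∪ G, fun x hx => ?_⟩
    simp [hF x fun i hi => hx i (Finset.mem_union_left _ hi),
      hG x fun i hi => hx i (Finset.mem_union_right _ hi)]
  zero_mem' := ⟨∅, by simp⟩
  smul_mem' := by
    rintro c ω ⟨F, hF⟩
    exact ⟨F, fun x hx => by simp [hF x hx]⟩

/-- The topology `σ(M(A), Â)` on `M(A)`: the coarsest one making all `ω ∈ Â` continuous. -/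
@[reducible] noncomputable def sigmaTopology (d : I → ℕ) : TopologicalSpace (M d) :=
  ⨅ ω : dual d, TopologicalSpace.induced (fun x : M d => (ω : Module.Dual ℂ (M d)) x) inferInstance

/-- The elementary tensor `x ⊗ y ∈ M(A ⊗ A)` of `x, y ∈ M(A)`. -/
def tmul {d : I → ℕ} (x y : M d) : M₂ d := fun p => x p.1 ⊗ₖ y p.2

/-- The algebraic tensor product `V ⊗ W` of subspaces of `M(A)`, inside `M(A ⊗ A)`. -/
def tensor {d : I → ℕ} (V W : Submodule ℂ (M d)) : Submodule ℂ (M₂ d) :=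
  Submodule.span ℂ {t | ∃ x ∈ V, ∃ y ∈ W, t = tmul x y}

/-- The flip `X ↦ X₂₁` of `M(A ⊗ A)`. -/
def flip {d : I → ℕ} (X : M₂ d) : M₂ d :=
  fun p => Matrix.of fun s t => X (p.2, p.1) (s.2, s.1) (t.2, t.1)

/-- `X₁₂ = X ⊗ 1`. -/
def leg₁₂ {d : I → ℕ} (X : M₂ d) : M₃ d := fun p => Matrix.of fun s t =>
  if s.2.2 = t.2.2 then X (p.1, p.2.1) (s.1, s.2.1) (t.1, t.2.1) else 0

/-- `X₁₃`. -/
def leg₁₃ {d : I → ℕ} (X : M₂ d) : M₃ d := fun p => Matrix.of fun s t =>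
  if s.2.1 = t.2.1 then X (p.1, p.2.2) (s.1, s.2.2) (t.1, t.2.2) else 0

/-- `X₂₃ = 1 ⊗ X`. -/
def leg₂₃ {d : I → ℕ} (X : M₂ d) : M₃ d := fun p => Matrix.of fun s t =>
  if s.1 = t.1 then X p.2 s.2 t.2 else 0

/-- The slice of `X ∈ M(A ⊗ A)` by the matrix coefficient `y ↦ (y j) b b'` in the second leg:
`X = ∑ coeff₁ X j b b' ⊗ e_{b b'}` over the matrix units `e_{b b'}` of the blocks `j`. -/
def coeff₁ {d : I → ℕ} (X : M₂ d) (j : I) (b b' : Fin (d j)) : M d :=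
  fun i => Matrix.of fun a a' => X (i, j) (a, b) (a', b')

/-- The slice of `X ∈ M(A ⊗ A)` by the matrix coefficient `y ↦ (y i) a a'` in the first leg. -/
def coeff₂ {d : I → ℕ} (X : M₂ d) (i : I) (a a' : Fin (d i)) : M d :=
  fun j => Matrix.of fun b b' => X (i, j) (a, b) (a', b')

/-- The slice map `(ω ⊗ ι) : M(A ⊗ A) → M(A)`. -/
def sliceLeft {d : I → ℕ} (ω : M d → ℂ) (X : M₂ d) : M d :=
  fun j => Matrix.of fun b b' => ω (coeff₁ X j b b')

/-- The slice map `(ι ⊗ η) : M(A ⊗ A) → M(A)`. -/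
def sliceRight {d : I → ℕ} (η : M d → ℂ) (X : M₂ d) : M d :=
  fun i => Matrix.of fun a a' => η (coeff₂ X i a a')

/-- `(Δ ⊗ ι) : M(A ⊗ A) → M(A ⊗ A ⊗ A)`. -/
def comulLeft {d : I → ℕ} (Δ : M d → M₂ d) (X : M₂ d) : M₃ d := fun p => Matrix.of fun s t =>
  Δ (coeff₁ X p.2.2 s.2.2 t.2.2) (p.1, p.2.1) (s.1, s.2.1) (t.1, t.2.1)

/-- `(ι ⊗ Δ) : M(A ⊗ A) → M(A ⊗ A ⊗ A)`. -/
def comulRight {d : I → ℕ} (Δ : M d → M₂ d) (X : M₂ d) : M₃ d := fun p => Matrix.of fun s t =>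
  Δ (coeff₂ X p.1 s.1 t.1) p.2 s.2 t.2

/-- `m (S ⊗ ι) : M(A ⊗ A) → M(A)`, where `m` is the multiplication map (which only sees the
diagonal blocks `B(Hⱼ) ⊗ B(Hⱼ)`). -/
def mulMapLeft {d : I → ℕ} (S : M d → M d) (X : M₂ d) : M d :=
  fun j => Matrix.of fun a c => ∑ b, S (coeff₁ X j b c) j a b

/-- `m (ι ⊗ S) : M(A ⊗ A) → M(A)`. -/
def mulMapRight {d : I → ℕ} (S : M d → M d) (X : M₂ d) : M d :=
  fun i => Matrix.of fun a c => ∑ b, S (coeff₂ X i a b) i b c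

/-- A discrete Hopf `*`-algebra structure on `A = ⨁ᵢ B(Hᵢ)`, `dim Hᵢ = d i`. All structure maps
are given by their canonical extensions to the multiplier algebras: by nondegeneracy, a `*`-homomorphism
`M(A) → M(A ⊗ A)` as below is the same as a nondegenerate `*`-homomorphism `A → M(A ⊗ A)`, and an
anti-automorphism of `M(A)` permutes the blocks, so it is the same as an anti-automorphism
of `A`. -/
structure DiscreteHopfStarAlgebra (d : I → ℕ) where
  /-- the comultiplication `Δ` -/
  comul : M d →⋆ₐ[ℂ] M₂ d
  /-- `Δ(A)(A ⊗ A) = A ⊗ A` -/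
  comul_nondegenerate :
    Submodule.span ℂ {y : M₂ d | ∃ a ∈ alg d, ∃ t ∈ alg₂ d, y = comul a * t}
      = (alg₂ d).toSubmodule
  coassoc : ∀ x, comulLeft comul (comul x) = comulRight comul (comul x)
  /-- the counit `ε` -/
  counit : M d →ₐ[ℂ] ℂ
  /-- `ε` does not vanish on `A` -/
  counit_nondegenerate : ∃ a ∈ alg d, counit a ≠ 0
  counit_left : ∀ x, sliceLeft counit (comul x) = x
  counit_right : ∀ x, sliceRight counit (comul x) = x
  /-- the antipode `S` -/
  antipode : M d ≃ₗ[ℂ] M d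
  antipode_mul : ∀ x y, antipode (x * y) = antipode y * antipode x
  antipode_left : ∀ x, mulMapLeft antipode (comul x) = counit x • (1 : M d)
  antipode_right : ∀ x, mulMapRight antipode (comul x) = counit x • (1 : M d)

/-- `R ∈ M(A ⊗ A)` is an R-matrix for the discrete Hopf `*`-algebra `A`, that is, `(A, R)` is
quasitriangular. -/
structure IsRMatrix {d : I → ℕ} (A : DiscreteHopfStarAlgebra d) (R : (M₂ d)ˣ) : Prop where
  comul_op : ∀ x, flip (A.comul x) = (R : M₂ d) * A.comul x * ((R⁻¹ : (M₂ d)ˣ) : M₂ d)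
  comul_left : comulLeft A.comul (R : M₂ d) = leg₁₃ (R : M₂ d) * leg₂₃ (R : M₂ d)
  comul_right : comulRight A.comul (R : M₂ d) = leg₁₃ (R : M₂ d) * leg₁₂ (R : M₂ d)
  star_eq : star (R : M₂ d) = flip (R : M₂ d)

/-- The multipliers, inside an ambient algebra `E`, of a subalgebra `V ⊆ E`. When `V` sits
nondegenerately in `E = M(A)` or `E = M(A ⊗ A)`, this is the multiplier algebra `M(V)`,
in its canonical embedding into `E`. -/
def multipliers {E : Type u} [Ring E] [Algebra ℂ E] (V : Submodule ℂ E) : Set E :=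
  {x | ∀ v ∈ V, x * v ∈ V ∧ v * x ∈ V}

/-- A `*`-subalgebra `B ⊆ M(A)` sits in `M(A)` nondegenerately: `BA = A`. -/
def SitsNondegenerately {d : I → ℕ} (B : NonUnitalStarSubalgebra ℂ (M d)) : Prop :=
  Submodule.span ℂ {y : M d | ∃ b ∈ B, ∃ a ∈ alg d, y = b * a} = (alg d).toSubmodule

/-- `B ⊆ M(A)` is a discrete Hopf `*`-subalgebra: `B` is a direct sum of full matrix algebras, and
the comultiplication, counit and antipode of `A` restrict to such structure maps on `B`, that is,
`Δ` restricts to a nondegenerate `B → M(B ⊗ B)`, `ε` to a nonzero character, and `S(B) = B`. -/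
structure IsDiscreteHopfStarSubalgebra {d : I → ℕ} (A : DiscreteHopfStarAlgebra d)
    (B : NonUnitalStarSubalgebra ℂ (M d)) : Prop where
  directSum : ∃ (L : Type u) (m : L → ℕ), (∀ l, 0 < m l) ∧
    Nonempty (B ≃⋆ₐ[ℂ] finSupp fun l => Fin (m l))
  comul_mem : ∀ b ∈ B, A.comul b ∈ multipliers (tensor B.toSubmodule B.toSubmodule)
  comul_nondegenerate :
    Submodule.span ℂ {y : M₂ d | ∃ b ∈ B, ∃ t ∈ tensor B.toSubmodule B.toSubmodule,
      y = A.comul b * t} = tensor B.toSubmodule B.toSubmodule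
  counit_nondegenerate : ∃ b ∈ B, A.counit b ≠ 0
  antipode_image : A.antipode '' (B : Set (M d)) = B

/-- The linear span `U_R` of the elements `(ω ⊗ ι)(R) (ι ⊗ η)(R)`, `ω, η ∈ Â`. -/
def sliceSpan {d : I → ℕ} (R : M₂ d) : Submodule ℂ (M d) :=
  Submodule.span ℂ {x | ∃ ω ∈ dual d, ∃ η ∈ dual d, x = sliceLeft ω R * sliceRight η R}

/-- A subspace `U ⊆ M(A)` is an (ordinary, algebraic) unital Hopf `*`-algebra under the
restrictions of the structure maps of `M(A)`. -/
structure IsHopfStarSubalgebra {d : I → ℕ} (A : DiscreteHopfStarAlgebra d)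
    (U : Submodule ℂ (M d)) : Prop where
  one_mem : (1 : M d) ∈ U
  mul_mem : ∀ x ∈ U, ∀ y ∈ U, x * y ∈ U
  star_mem : ∀ x ∈ U, star x ∈ U
  comul_mem : ∀ x ∈ U, A.comul x ∈ tensor U U
  antipode_image : A.antipode '' (U : Set (M d)) = U

end DiscreteHopf

/-!
Let `Rₗ` (`leftLeg`) and `Rᵣ` (`rightLeg`) be the spans of the slices `(ω ⊗ ι)(R)` and `(ι ⊗ η)(R)`,
so that `U_R = Rₗ Rᵣ`. The formulas for `(Δ ⊗ ι)(R)` and `(ι ⊗ Δ)(R)` make both of them bialgebras,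
`R* = R₂₁` shows that `*` exchanges them, and `(S ⊗ ι)(R) = R⁻¹`, `(ι ⊗ S)(R⁻¹) = R` show that `S`
preserves each of them. A slice of the Yang-Baxter equation relates the products `Rₗ Rᵣ` and
`Rᵣ Rₗ`; the scalar matrices in it are partial transposes of `R`, which are inverted by
`(ι ⊗ S)(R)` (`exchange`, `rightLeg_mul_leftLeg_le`). Hence `Rₗ Rᵣ = Rᵣ Rₗ`, and `U_R` is a Hopf
`*`-subalgebra (`isHopfStarSubalgebra_sliceSpan`).

For any unital Hopf `*`-subalgebra `U` of `M(A)`, let `N` be the set of elements of `M(A)` that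
agree on every finite set of blocks with an element of `U`. This lies in the `σ(M(A), Â)`-closure
of `U`. Then `B` is the *finite part* of `N`: the elements annihilated by the ideal of all `y ∈ N`
vanishing on some finite set of blocks. For every finite set `F` of blocks, `B` contains a central
projection of `N` that is `1` on `F` (`exists_central_local_unit`); it is glued from the units of
finite-dimensional `*`-algebras, which exist because the form `tr(xy)` is nondegenerate on a
`*`-closed space of matrices (`exists_unit_of_fintype`). It follows that `M(B) = N`, that
`BA = A`, and that `N b` and `b N` are finite-dimensional for `b ∈ B`. A finite-dimensional
subspace of a product of matrix algebras is determined by finitely many blocks (`exists_finset_separating`),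
and each block of `Δ(x)` and of `S(x)` depends on finitely many blocks of `x` (`comul_local`,
`antiAut_local`), so that the inclusions known for `U` pass to `N` and `B`.

That `B` is a direct sum of matrix algebras (`exists_starAlgEquiv_finSupp`) is seen from minimal
projections `e`: the space `N e` is a finite-dimensional Hilbert space with `x* y = ⟨x, y⟩ e`, and
an orthonormal basis `fₐ` of it gives matrix units `fₐ f_b*` of a minimal ideal of `N` with unit
`∑ₐ fₐ fₐ*`.
-/

namespace DiscreteHopf

/-! ### Finite-dimensional subspaces and subalgebras of a product of matrix algebras -/

section Restriction

variable {J : Type u} {n : J → Type}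

/-- The subspace of elements of `V` that vanish on the blocks in `F`. -/
def vanishingOn (V : Submodule ℂ (Blocks n)) (F : Finset J) : Submodule ℂ (Blocks n) where
  carrier := {v | v ∈ V ∧ ∀ j ∈ F, v j = 0}
  add_mem' := fun ⟨h, h'⟩ ⟨k, k'⟩ => ⟨V.add_mem h k, fun j hj => by simp [h' j hj, k' j hj]⟩
  zero_mem' := ⟨V.zero_mem, fun _ _ => rfl⟩
  smul_mem' := fun c _ ⟨h, h'⟩ => ⟨V.smul_mem c h, fun j hj => by simp [h' j hj]⟩

/-- A finite-dimensional subspace is determined by finitely many blocks: a finite set `F` for which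
the subspace of elements vanishing on `F` has the least possible dimension does it. -/
theorem exists_finset_separating (V : Submodule ℂ (Blocks n)) [FiniteDimensional ℂ V] :
    ∃ F : Finset J, ∀ v ∈ V, (∀ j ∈ F, v j = 0) → v = 0 := by
  classical
  have hle : ∀ F, vanishingOn V F ≤ V := fun F v hv => hv.1
  have hfd : ∀ F, FiniteDimensional ℂ (vanishingOn V F) := fun F =>
    Submodule.finiteDimensional_of_le (hle F)
  obtain ⟨F, hF⟩ : ∃ F : Finset J, ∀ G : Finset J,
      Module.finrank ℂ (vanishingOn V F) ≤ Module.finrank ℂ (vanishingOn V G) := by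
    obtain ⟨F, hF⟩ := WellFounded.has_min
      (measure fun F : Finset J => Module.finrank ℂ (vanishingOn V F)).wf Set.univ ⟨∅, trivial⟩
    exact ⟨F, fun G => not_lt.mp (hF.2 G trivial)⟩
  refine ⟨F, fun v hv hvF => funext fun j => ?_⟩
  have hsub : vanishingOn V (insert j F) ≤ vanishingOn V F := fun w hw =>
    ⟨hw.1, fun k hk => hw.2 k (Finset.mem_insert_of_mem hk)⟩
  have heq := Submodule.eq_of_le_of_finrank_le hsub (hF _)
  have hmem : v ∈ vanishingOn V (insert j F) := heq ▸ ⟨hv, hvF⟩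
  exact hmem.2 j (Finset.mem_insert_self j F)

/-- A finite-dimensional subspace is closed for the topology of blockwise agreement. -/
theorem mem_of_forall_agree (V : Submodule ℂ (Blocks n)) [FiniteDimensional ℂ V] (x : Blocks n)
    (hx : ∀ F : Finset J, ∃ v ∈ V, ∀ j ∈ F, v j = x j) : x ∈ V := by
  classical
  obtain ⟨F, hF⟩ := exists_finset_separating V
  obtain ⟨v, hv, hvx⟩ := hx F
  have : x = v := funext fun j => by
    obtain ⟨w, hw, hwx⟩ := hx (insert j F)
    have h0 : w - v = 0 := hF _ (V.sub_mem hw hv) fun k hk => by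
      simp [hvx k hk, hwx k (Finset.mem_insert_of_mem hk)]
    rw [← hwx j (Finset.mem_insert_self j F), sub_eq_zero.mp h0]
  exact this ▸ hv

theorem finiteDimensional_of_separating [∀ j, Fintype (n j)] (V : Submodule ℂ (Blocks n))
    (F : Finset J) (hF : ∀ v ∈ V, (∀ j ∈ F, v j = 0) → v = 0) : FiniteDimensional ℂ V := by
  let f : V →ₗ[ℂ] (∀ j : F, Matrix (n j) (n j) ℂ) :=
    { toFun := fun v j => v.1 j
      map_add' := fun _ _ => rfl
      map_smul' := fun _ _ => rfl }
  refine Module.Finite.of_injective f ((injective_iff_map_eq_zero f).mpr fun v hv => ?_)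
  exact Subtype.ext (hF v v.2 fun j hj => congrFun hv ⟨j, hj⟩)

open scoped ComplexOrder in
theorem eq_zero_of_mul_star_self [∀ j, Fintype (n j)] {x : Blocks n} (h : x * star x = 0) : x = 0 :=
  funext fun j => Matrix.self_mul_conjTranspose_eq_zero.mp (congrFun h j)

open scoped ComplexOrder in
theorem eq_zero_of_star_mul_self [∀ j, Fintype (n j)] {x : Blocks n} (h : star x * x = 0) : x = 0 :=
  funext fun j => Matrix.conjTranspose_mul_self_eq_zero.mp (congrFun h j)

end Restriction

section Unit

variable {J : Type u} {n : J → Type} [∀ j, Fintype (n j)] [∀ j, DecidableEq (n j)]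

open scoped ComplexOrder in
/-- A `*`-subalgebra of a finite product of matrix algebras has a unit: the form `tr(xy)` is
nondegenerate on it, because it is closed under `*`, and the element representing `tr` is a unit. -/
theorem exists_unit_of_fintype [Fintype J] (W : NonUnitalStarSubalgebra ℂ (Blocks n)) :
    ∃ q ∈ W, ∀ y ∈ W, q * y = y ∧ y * q = y := by
  let tr : Blocks n →ₗ[ℂ] ℂ := ∑ j, (Matrix.traceLinearMap (n j) ℂ ℂ).comp (LinearMap.proj j)
  have htr : ∀ x, tr x = ∑ j, (x j).trace := fun x => by simp [tr]
  have htr_comm : ∀ x y, tr (x * y) = tr (y * x) := fun x y => by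
    simp only [htr, Pi.mul_apply]
    exact Finset.sum_congr rfl fun j _ => Matrix.trace_mul_comm _ _
  have htr_pos : ∀ x, tr (x * star x) = 0 → x = 0 := by
    intro x hx
    have hx : ∑ j, (x j * (x j).conjTranspose).trace = 0 := (htr _).symm.trans hx
    rw [Finset.sum_eq_zero_iff_of_nonneg fun j _ =>
      (Matrix.posSemidef_self_mul_conjTranspose (x j)).trace_nonneg] at hx
    funext j
    exact Matrix.trace_mul_conjTranspose_self_eq_zero_iff.mp (hx j (Finset.mem_univ j))
  let V := W.toSubmodule
  let β : V →ₗ[ℂ] Module.Dual ℂ V := LinearMap.mk₂ ℂ (fun x y => tr (x.1 * y.1))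
    (fun x y z => by simp [add_mul]) (fun c x y => by simp)
    (fun x y z => by simp [mul_add]) (fun c x y => by simp)
  have hinj : Function.Injective β := (injective_iff_map_eq_zero β).mpr fun x hx =>
    Subtype.ext (htr_pos _ (LinearMap.congr_fun hx ⟨star x.1, W.star_mem' x.2⟩))
  obtain ⟨⟨q, hq⟩, hqtr⟩ := (LinearMap.injective_iff_surjective_of_finrank_eq_finrank
    Subspace.dual_finrank_eq.symm).mp hinj (tr.comp V.subtype)
  have key : ∀ y ∈ W, tr (q * y) = tr y := fun y hy => LinearMap.congr_fun hqtr ⟨y, hy⟩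
  have hdeg : ∀ y ∈ W, (∀ z ∈ W, tr (y * z) = 0) → y = 0 := fun y hy h =>
    htr_pos y (h _ (W.star_mem' hy))
  refine ⟨q, hq, fun y hy => ⟨sub_eq_zero.mp (hdeg _ (sub_mem (W.mul_mem hq hy) hy) ?_),
    sub_eq_zero.mp (hdeg _ (sub_mem (W.mul_mem hy hq) hy) ?_)⟩⟩
  · intro z hz
    rw [sub_mul, map_sub, mul_assoc, key _ (W.mul_mem hy hz), sub_self]
  · intro z hz
    rw [sub_mul, map_sub, mul_assoc, htr_comm, mul_assoc, key _ (W.mul_mem hz hy), htr_comm,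
      sub_self]

/-- The restriction of a product of matrix algebras to the blocks in `G`. -/
def restrict (G : Finset J) : Blocks n →⋆ₙₐ[ℂ] Blocks (fun j : G => n j) where
  toFun x j := x j
  map_smul' _ _ := rfl
  map_zero' := rfl
  map_add' _ _ := rfl
  map_mul' _ _ := rfl
  map_star' _ := rfl

theorem exists_unit_on (W : NonUnitalStarSubalgebra ℂ (Blocks n)) (G : Finset J) :
    ∃ q ∈ W, ∀ y ∈ W, ∀ j ∈ G, (q * y) j = y j ∧ (y * q) j = y j := by
  obtain ⟨_, ⟨q, hq, rfl⟩, h⟩ := exists_unit_of_fintype (W.map (restrict G))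
  refine ⟨q, hq, fun y hy j hj => ?_⟩
  have := h _ ⟨y, hy, rfl⟩
  exact ⟨congrFun this.1 ⟨j, hj⟩, congrFun this.2 ⟨j, hj⟩⟩

theorem exists_unit (W : NonUnitalStarSubalgebra ℂ (Blocks n))
    [FiniteDimensional ℂ W.toSubmodule] : ∃ q ∈ W, ∀ y ∈ W, q * y = y ∧ y * q = y := by
  obtain ⟨F, hF⟩ := exists_finset_separating W.toSubmodule
  obtain ⟨q, hq, h⟩ := exists_unit_on W F
  exact ⟨q, hq, fun y hy =>
    ⟨sub_eq_zero.mp (hF _ (sub_mem (W.mul_mem hq hy) hy) fun j hj => by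
        rw [Pi.sub_apply, (h y hy j hj).1, sub_self]),
      sub_eq_zero.mp (hF _ (sub_mem (W.mul_mem hy hq) hy) fun j hj => by
        rw [Pi.sub_apply, (h y hy j hj).2, sub_self])⟩⟩

end Unit

/-! ### The finite part of a blockwise closed `*`-subalgebra -/

section FinitePart

variable {J : Type u} {n : J → Type} [∀ j, Fintype (n j)] [∀ j, DecidableEq (n j)]

/-- `N` contains every element that agrees on each finite set of blocks with an element of `N`. -/
def IsBlockClosed (N : StarSubalgebra ℂ (Blocks n)) : Prop :=
  ∀ x, (∀ F : Finset J, ∃ v ∈ N, ∀ j ∈ F, v j = x j) → x ∈ N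

/-- The ideal of elements of `N` vanishing on `F`. -/
def vanishingIdeal (N : StarSubalgebra ℂ (Blocks n)) (F : Finset J) :
    NonUnitalStarSubalgebra ℂ (Blocks n) where
  carrier := {y | y ∈ N ∧ ∀ j ∈ F, y j = 0}
  add_mem' := fun ⟨h, h'⟩ ⟨k, k'⟩ => ⟨add_mem h k, fun j hj => by simp [h' j hj, k' j hj]⟩
  zero_mem' := ⟨zero_mem N, fun _ _ => rfl⟩
  mul_mem' := fun ⟨h, h'⟩ ⟨k, _⟩ => ⟨mul_mem h k, fun j hj => by simp [h' j hj]⟩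
  smul_mem' := fun c _ ⟨h, h'⟩ => ⟨N.smul_mem h c, fun j hj => by simp [h' j hj]⟩
  star_mem' := fun ⟨h, h'⟩ => ⟨star_mem h, fun j hj => by simp [h' j hj]⟩

/-- The finite part of `N`: the elements annihilated by the ideal of elements vanishing on some
finite set of blocks. If `N` is blockwise closed, so that `N ≅ ∏ₗ B(Kₗ)`, this is `⨁ₗ B(Kₗ)`. -/
def finitePart (N : StarSubalgebra ℂ (Blocks n)) : NonUnitalStarSubalgebra ℂ (Blocks n) where
  carrier := {b | b ∈ N ∧ ∃ F : Finset J, ∀ y ∈ vanishingIdeal N F, y * b = 0 ∧ b * y = 0}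
  add_mem' := by
    classical
    rintro a b ⟨ha, F, hF⟩ ⟨hb, G, hG⟩
    refine ⟨add_mem ha hb, F ∪ G, fun y hy => ?_⟩
    have h1 := hF y ⟨hy.1, fun j hj => hy.2 j (Finset.mem_union_left _ hj)⟩
    have h2 := hG y ⟨hy.1, fun j hj => hy.2 j (Finset.mem_union_right _ hj)⟩
    simp [mul_add, add_mul, h1, h2]
  zero_mem' := ⟨zero_mem N, ∅, fun y _ => by simp⟩
  mul_mem' := by
    classical
    rintro a b ⟨ha, F, hF⟩ ⟨hb, G, hG⟩
    refine ⟨mul_mem ha hb, F ∪ G, fun y hy => ?_⟩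
    have h1 := hF y ⟨hy.1, fun j hj => hy.2 j (Finset.mem_union_left _ hj)⟩
    have h2 := hG y ⟨hy.1, fun j hj => hy.2 j (Finset.mem_union_right _ hj)⟩
    rw [← mul_assoc, h1.1, mul_assoc, h2.2]
    simp
  smul_mem' := by
    rintro c b ⟨hb, F, hF⟩
    exact ⟨N.smul_mem hb c, F, fun y hy => by simp [hF y hy]⟩
  star_mem' := by
    rintro b ⟨hb, F, hF⟩
    refine ⟨star_mem hb, F, fun y hy => ?_⟩
    have h := hF (star y) ((vanishingIdeal N F).star_mem' hy)
    constructor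
    · simpa using congrArg star h.2
    · simpa using congrArg star h.1

variable {N : StarSubalgebra ℂ (Blocks n)}

theorem finitePart_le {b : Blocks n} (hb : b ∈ finitePart N) : b ∈ N := hb.1

theorem mul_mem_finitePart {x b : Blocks n} (hx : x ∈ N) (hb : b ∈ finitePart N) :
    x * b ∈ finitePart N := by
  obtain ⟨hb, F, hF⟩ := hb
  refine ⟨mul_mem hx hb, F, fun y hy => ⟨?_, ?_⟩⟩
  · rw [← mul_assoc]
    exact (hF (y * x) ⟨mul_mem hy.1 hx, fun j hj => by simp [hy.2 j hj]⟩).1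
  · rw [mul_assoc, (hF y hy).2, mul_zero]

theorem finitePart_mul_mem {x b : Blocks n} (hx : x ∈ N) (hb : b ∈ finitePart N) :
    b * x ∈ finitePart N := by
  have := mul_mem_finitePart (star_mem hx) ((finitePart N).star_mem' hb)
  simpa using (finitePart N).star_mem' this

/-- For every finite set `F` of blocks, `N` contains an element that is `1` on `F` and annihilates
all elements vanishing on `F`. On each finite set of blocks it is the complement of the unit of
a finite-dimensional `*`-algebra; these complements are unique and hence fit together. -/
theorem exists_local_unit (hN : IsBlockClosed N) (F : Finset J) :
    ∃ p ∈ N, (∀ j ∈ F, p j = 1) ∧ ∀ y ∈ vanishingIdeal N F, p * y = 0 ∧ y * p = 0 := by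
  classical
  have hex : ∀ G : Finset J, ∃ u ∈ N, (∀ j ∈ F, u j = 1) ∧
      ∀ y ∈ vanishingIdeal N F, ∀ j ∈ G, u j * y j = 0 ∧ y j * u j = 0 := by
    intro G
    obtain ⟨q, hq, h⟩ := exists_unit_on (vanishingIdeal N F) G
    refine ⟨1 - q, sub_mem (one_mem N) hq.1, fun j hj => by simp [hq.2 j hj], fun y hy j hj => ?_⟩
    have := h y hy j hj
    simp only [Pi.mul_apply] at this
    simp [sub_mul, mul_sub, this]
  choose u huN huF hu using hex
  have huniq : ∀ G G' : Finset J, ∀ j ∈ G, j ∈ G' → u G j = u G' j := by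
    intro G G' j hj hj'
    have hv : ∀ H, 1 - u H ∈ vanishingIdeal N F := fun H =>
      ⟨sub_mem (one_mem N) (huN H), fun k hk => by simp [huF H k hk]⟩
    have h1 := (hu G _ (hv G') j hj).1
    have h2 := (hu G' _ (hv G) j hj').2
    simp only [Pi.sub_apply, Pi.one_apply, mul_sub, sub_mul, mul_one, one_mul, sub_eq_zero]
      at h1 h2
    rw [h1, ← h2]
  refine ⟨fun j => u {j} j, hN _ fun G => ⟨u G, huN G, fun j hj =>
      huniq G {j} j hj (Finset.mem_singleton_self j)⟩, fun j hj => huF _ j hj, fun y hy =>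
      ⟨funext fun j => (hu {j} y hy j (Finset.mem_singleton_self j)).1,
        funext fun j => (hu {j} y hy j (Finset.mem_singleton_self j)).2⟩⟩

/-- A central projection of `N`. -/
structure IsCentralProj (N : StarSubalgebra ℂ (Blocks n)) (p : Blocks n) : Prop where
  mem : p ∈ N
  star_eq : star p = p
  mul_self : p * p = p
  comm : ∀ x ∈ N, p * x = x * p

/-- The local units are central projections in the finite part. -/
theorem exists_central_local_unit (hN : IsBlockClosed N) (F : Finset J) :
    ∃ p, IsCentralProj N p ∧ p ∈ finitePart N ∧ (∀ j ∈ F, p j = 1) ∧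
      ∀ y ∈ vanishingIdeal N F, p * y = 0 ∧ y * p = 0 := by
  obtain ⟨p, hp, hpF, hpy⟩ := exists_local_unit hN F
  have hv : 1 - p ∈ vanishingIdeal N F := ⟨sub_mem (one_mem N) hp, fun k hk => by simp [hpF k hk]⟩
  have hv' := (vanishingIdeal N F).star_mem' hv
  have hl : ∀ x ∈ N, x * (1 - p) ∈ vanishingIdeal N F := fun x hx =>
    ⟨mul_mem hx hv.1, fun k hk => by simp [hpF k hk]⟩
  have hr : ∀ x ∈ N, (1 - p) * x ∈ vanishingIdeal N F := fun x hx =>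
    ⟨mul_mem hv.1 hx, fun k hk => by simp [hpF k hk]⟩
  have hsq : p * p = p := by
    have := (hpy _ hv).1
    rw [mul_sub, mul_one, sub_eq_zero] at this
    exact this.symm
  have hstar : star p = p := by
    have h1 : p * star p = p := by
      have : p * star (1 - p) = 0 := (hpy _ hv').1
      rw [star_sub, star_one, mul_sub, mul_one, sub_eq_zero] at this
      exact this.symm
    have h2 := congrArg star h1
    rw [star_mul, star_star] at h2
    exact h2.symm.trans h1
  refine ⟨p, ⟨hp, hstar, hsq, fun x hx => ?_⟩, ⟨hp, F, fun y hy => ⟨(hpy y hy).2, (hpy y hy).1⟩⟩,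
    hpF, hpy⟩
  have h1 := (hpy _ (hl x hx)).1
  have h2 := (hpy _ (hr x hx)).2
  simp only [mul_sub, sub_mul, mul_one, one_mul, sub_eq_zero, ← mul_assoc] at h1 h2
  rw [h1, ← h2]

theorem exists_central_unit_of_mem (hN : IsBlockClosed N) {b : Blocks n} (hb : b ∈ finitePart N) :
    ∃ p, IsCentralProj N p ∧ p ∈ finitePart N ∧ p * b = b ∧ b * p = b := by
  obtain ⟨hb, F, hF⟩ := hb
  obtain ⟨p, hp, hpB, hpF, -⟩ := exists_central_local_unit hN F
  have := hF (1 - p) ⟨sub_mem (one_mem N) hp.mem, fun k hk => by simp [hpF k hk]⟩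
  simp only [mul_sub, sub_mul, mul_one, one_mul, sub_eq_zero] at this
  exact ⟨p, hp, hpB, this.1.symm, this.2.symm⟩

/-- The left ideal `N b`. -/
def leftIdeal (N : StarSubalgebra ℂ (Blocks n)) (b : Blocks n) : Submodule ℂ (Blocks n) :=
  N.toSubalgebra.toSubmodule.map (LinearMap.mulRight ℂ b)

/-- The right ideal `b N`. -/
def rightIdeal (N : StarSubalgebra ℂ (Blocks n)) (b : Blocks n) : Submodule ℂ (Blocks n) :=
  N.toSubalgebra.toSubmodule.map (LinearMap.mulLeft ℂ b)

theorem mem_leftIdeal {b x : Blocks n} : x ∈ leftIdeal N b ↔ ∃ y ∈ N, y * b = x := Iff.rfl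

theorem mul_mem_leftIdeal {b x : Blocks n} (hx : x ∈ N) : x * b ∈ leftIdeal N b := ⟨x, hx, rfl⟩

theorem finiteDimensional_leftIdeal (hN : IsBlockClosed N) {b : Blocks n}
    (hb : b ∈ finitePart N) : FiniteDimensional ℂ (leftIdeal N b) := by
  obtain ⟨hb, F, hF⟩ := hb
  obtain ⟨p, hp, hpB, hpF, hpy⟩ := exists_central_local_unit hN F
  refine finiteDimensional_of_separating _ F ?_
  rintro _ ⟨y, hy, rfl⟩ h0
  change y * b = 0
  have h1 := (hpy (y * b) ⟨mul_mem hy hb, h0⟩).1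
  have h2 := (hF (1 - p) ⟨sub_mem (one_mem N) hp.mem, fun k hk => by simp [hpF k hk]⟩).1
  rw [sub_mul, one_mul, sub_eq_zero] at h2
  rw [h2, ← mul_assoc, ← hp.comm y hy, mul_assoc, h1]

theorem finiteDimensional_rightIdeal (hN : IsBlockClosed N) {b : Blocks n}
    (hb : b ∈ finitePart N) : FiniteDimensional ℂ (rightIdeal N b) := by
  obtain ⟨hb, F, hF⟩ := hb
  obtain ⟨p, hp, hpB, hpF, hpy⟩ := exists_central_local_unit hN F
  refine finiteDimensional_of_separating _ F ?_
  rintro _ ⟨y, hy, rfl⟩ h0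
  change b * y = 0
  have h1 := (hpy (b * y) ⟨mul_mem hb hy, h0⟩).2
  have h2 := (hF (1 - p) ⟨sub_mem (one_mem N) hp.mem, fun k hk => by simp [hpF k hk]⟩).2
  rw [mul_sub, mul_one, sub_eq_zero] at h2
  rw [h2, mul_assoc, hp.comm y hy, ← mul_assoc, h1]

end FinitePart

/-! ### Minimal projections and matrix units -/

section MinimalProj

variable {J : Type u} {n : J → Type} [∀ j, Fintype (n j)] [∀ j, DecidableEq (n j)]

/-- A minimal projection of `N`: a nonzero projection `e` with `e N e = ℂ e`. -/
structure IsMinimalProj (N : StarSubalgebra ℂ (Blocks n)) (e : Blocks n) : Prop where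
  mem : e ∈ N
  star_eq : star e = e
  mul_self : e * e = e
  ne_zero : e ≠ 0
  corner : ∀ x ∈ N, ∃ c : ℂ, e * x * e = c • e

variable {N : StarSubalgebra ℂ (Blocks n)}

/-- The `*`-algebra `y N y*`. -/
def hereditary (N : StarSubalgebra ℂ (Blocks n)) (y : Blocks n) (hy : y ∈ N) :
    NonUnitalStarSubalgebra ℂ (Blocks n) where
  carrier := {w | ∃ x ∈ N, w = y * x * star y}
  add_mem' := by
    rintro _ _ ⟨a, ha, rfl⟩ ⟨b, hb, rfl⟩
    exact ⟨a + b, add_mem ha hb, by simp [mul_add, add_mul]⟩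
  zero_mem' := ⟨0, zero_mem N, by simp⟩
  mul_mem' := by
    rintro _ _ ⟨a, ha, rfl⟩ ⟨b, hb, rfl⟩
    exact ⟨a * (star y * y) * b, mul_mem (mul_mem ha (mul_mem (star_mem hy) hy)) hb,
      by simp only [mul_assoc]⟩
  smul_mem' := by
    rintro c _ ⟨a, ha, rfl⟩
    exact ⟨c • a, N.smul_mem ha c, by simp⟩
  star_mem' := by
    rintro _ ⟨a, ha, rfl⟩
    exact ⟨star a, star_mem ha, by simp [mul_assoc]⟩

/-- A projection `e` with `e N e ≠ ℂ e` has a proper nonzero subprojection. For `x ∈ e N e` outside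
`ℂ e`, right multiplication by `x` has an eigenvector `c` in `e N e`, say `c x = λ c`. With
`y = x - λ e`, the subprojection is the unit of `y N y*`. -/
theorem exists_subprojection {e x : Blocks n} (he : e ∈ N) (hs : star e = e) (hm : e * e = e)
    (h0 : e ≠ 0) [FiniteDimensional ℂ (leftIdeal N e)] (hx : x ∈ N)
    (hne : ∀ c : ℂ, e * x * e ≠ c • e) :
    ∃ q ∈ N, star q = q ∧ q * q = q ∧ q ≠ 0 ∧ q ≠ e ∧ q * e = q := by
  let T : leftIdeal N e →ₗ[ℂ] leftIdeal N e :=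
    (LinearMap.mulRight ℂ (e * x * e)).restrict (by
      rintro _ ⟨y, hy, rfl⟩
      exact mem_leftIdeal.mpr ⟨y * e * (e * x), mul_mem (mul_mem hy he) (mul_mem he hx),
        by simp [mul_assoc]⟩)
  have : Nontrivial (leftIdeal N e) :=
    ⟨⟨⟨e, 1, one_mem N, by simp⟩, 0, fun h => h0 (congrArg Subtype.val h)⟩⟩
  obtain ⟨c, hc⟩ := Module.End.exists_eigenvalue T
  obtain ⟨⟨v, w, hw, hv⟩, hvT⟩ := hc.exists_hasEigenvector
  have hv0 : v ≠ 0 := fun h => hvT.2 (Subtype.ext h)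
  have hvc : v * (e * x * e) = c • v := congrArg Subtype.val hvT.apply_eq_smul
  have hve : v * e = v := by
    rw [← hv]
    change w * e * e = w * e
    rw [mul_assoc, hm]
  set y := e * x * e - c • e with hy
  have hyN : y ∈ N := sub_mem (mul_mem (mul_mem he hx) he) (N.smul_mem he c)
  have hy0 : y ≠ 0 := sub_ne_zero.mpr (hne c)
  have hvy : v * y = 0 := by rw [hy, mul_sub, hvc, mul_smul_comm, hve, sub_self]
  have hey : e * y = y := by simp [hy, mul_sub, ← mul_assoc, hm]
  have hye : star y * e = star y := by simpa [hs] using congrArg star hey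
  have hfd : FiniteDimensional ℂ (hereditary N y hyN).toSubmodule :=
    Submodule.finiteDimensional_of_le (S₂ := leftIdeal N e) (by
      rintro _ ⟨a, ha, rfl⟩
      refine mem_leftIdeal.mpr ⟨y * a * star y, mul_mem (mul_mem hyN ha) (star_mem hyN), ?_⟩
      rw [mul_assoc, hye])
  obtain ⟨q, hq, hqu⟩ := exists_unit (hereditary N y hyN)
  have hq' := (hereditary N y hyN).star_mem' hq
  have hqs : star q = q := by
    have h1 := (hqu _ hq').1
    have h2 := congrArg star h1
    rw [star_mul, star_star] at h2
    exact h1.symm.trans h2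
  have hyy : y * star y ∈ hereditary N y hyN := ⟨1, one_mem N, by rw [mul_one]⟩
  obtain ⟨a, ha, hqa⟩ := hq
  refine ⟨q, hqa ▸ mul_mem (mul_mem hyN ha) (star_mem hyN), hqs, (hqu q ⟨a, ha, hqa⟩).1, ?_, ?_, ?_⟩
  · rintro rfl
    have := (hqu _ hyy).1
    rw [zero_mul] at this
    exact hy0 (eq_zero_of_mul_star_self this.symm)
  · rintro rfl
    apply hv0
    rw [← hve, hqa, ← mul_assoc, ← mul_assoc, hvy, zero_mul, zero_mul]
  · rw [hqa, mul_assoc, hye]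

/-- Below every nonzero projection `p` with `N p` finite-dimensional there is a minimal one, by
induction on the dimension `k` of `N p`. -/
theorem exists_minimalProj_le (k : ℕ) : ∀ {p : Blocks n}, p ∈ N → star p = p → p * p = p → p ≠ 0 →
    FiniteDimensional ℂ (leftIdeal N p) → Module.finrank ℂ (leftIdeal N p) = k →
    ∃ e, IsMinimalProj N e ∧ e * p = e := by
  induction k using Nat.strong_induction_on with
  | _ k ih =>
    intro p hp hs hm h0 hfd hk
    by_cases hmin : ∀ x ∈ N, ∃ c : ℂ, p * x * p = c • p
    · exact ⟨p, ⟨hp, hs, hm, h0, hmin⟩, hm⟩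
    push Not at hmin
    obtain ⟨x, hx, hne⟩ := hmin
    obtain ⟨q, hq, hqs, hqq, hq0, hqp, hqe⟩ := exists_subprojection hp hs hm h0 hx hne
    have hpq : p * q = q := by simpa [hs, hqs] using congrArg star hqe
    have hlt : leftIdeal N q < leftIdeal N p := by
      refine lt_of_le_of_ne ?_ fun h => ?_
      · rintro _ ⟨y, hy, rfl⟩
        refine mem_leftIdeal.mpr ⟨y * q, mul_mem hy hq, ?_⟩
        rw [mul_assoc, hqe, LinearMap.mulRight_apply]
      · have : p ∈ leftIdeal N q := h ▸ ⟨1, one_mem N, by simp⟩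
        obtain ⟨y, hy, hyp⟩ := this
        have hyp : y * q = p := hyp
        apply hqp
        rw [← hpq, ← hyp, mul_assoc, hqq]
    obtain ⟨e, he, heq⟩ := ih _ (hk ▸ Submodule.finrank_lt_finrank_of_lt hlt) hq hqs hqq hq0
      (Submodule.finiteDimensional_of_le hlt.le) rfl
    exact ⟨e, he, by rw [← heq, mul_assoc, hqe]⟩

/-- An orthonormal basis `f` of the left ideal `N e` of a minimal projection `e`, for the inner
product `⟨x, y⟩` given by `x* y = ⟨x, y⟩ e`. The elements `f a * star (f b)` are matrix units. -/
structure IsFrame (N : StarSubalgebra ℂ (Blocks n)) (e : Blocks n) {m : ℕ}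
    (f : Fin m → Blocks n) : Prop where
  minimal : IsMinimalProj N e
  mem : ∀ a, f a ∈ N
  mul_proj : ∀ a, f a * e = f a
  orthonormal : ∀ a b, star (f a) * f b = if a = b then e else 0
  expand : ∀ x ∈ N, x * e = ∑ a, f a * (star (f a) * (x * e))

/-- Let `e` be a minimal projection and `ξ` a unit vector in the range of the `j`-th block of `e`.
Then `x ↦ x ξ` embeds `N e` isometrically into a Euclidean space, and an orthonormal basis
of the range gives a frame. -/
theorem exists_frame {e : Blocks n} (he : IsMinimalProj N e) :
    ∃ (m : ℕ) (f : Fin m → Blocks n), IsFrame N e f := by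
  obtain ⟨j, hj⟩ : ∃ j, e j ≠ 0 := Function.ne_iff.mp he.ne_zero
  let π : Blocks n →ₐ[ℂ] (EuclideanSpace ℂ (n j) →L[ℂ] EuclideanSpace ℂ (n j)) :=
    (Matrix.toEuclideanCLM (𝕜 := ℂ) (n := n j)).toAlgEquiv.toAlgHom.comp (Pi.evalAlgHom ℂ _ j)
  have hπ_star : ∀ x, π (star x) = ContinuousLinearMap.adjoint (π x) := fun x =>
    map_star (Matrix.toEuclideanCLM (𝕜 := ℂ) (n := n j)) (x j)
  have hπe : π e ≠ 0 := fun h => hj (Matrix.toEuclideanCLM.injective (h.trans (map_zero _).symm))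
  obtain ⟨ξ, hξ1, hξe⟩ : ∃ ξ, ‖ξ‖ = 1 ∧ π e ξ = ξ := by
    obtain ⟨η, hη⟩ : ∃ η, π e η ≠ 0 := by
      by_contra! h
      exact hπe (ContinuousLinearMap.ext h)
    refine ⟨(‖π e η‖⁻¹ : ℂ) • π e η, norm_smul_inv_norm hη, ?_⟩
    rw [map_smul, ← mul_apply_eq_comp, ← map_mul, he.mul_self]
  let φ : Blocks n →ₗ[ℂ] EuclideanSpace ℂ (n j) :=
    (ContinuousLinearMap.apply' (EuclideanSpace ℂ (n j)) (RingHom.id ℂ) ξ).toLinearMap ∘ₗ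
      π.toLinearMap
  have hφ : ∀ x, φ x = π x ξ := fun _ => rfl
  have hinner : ∀ x y, inner ℂ (φ x) (φ y) = inner ℂ ξ (φ (star x * y)) := fun x y => by
    rw [hφ, hφ, hφ, map_mul, hπ_star, mul_apply_eq_comp,
      ContinuousLinearMap.adjoint_inner_right]
  have hmul : ∀ x ∈ leftIdeal N e, x * e = x := by
    rintro _ ⟨x, hx, rfl⟩
    rw [LinearMap.mulRight_apply, mul_assoc, he.mul_self]
  have hmem : ∀ x ∈ leftIdeal N e, x ∈ N := by
    rintro _ ⟨x, hx, rfl⟩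
    exact N.mul_mem hx he.mem
  have hstar : ∀ x ∈ leftIdeal N e, ∀ y ∈ leftIdeal N e,
      star x * y = (inner ℂ (φ x) (φ y) : ℂ) • e := by
    intro x hx y hy
    obtain ⟨c, hc⟩ := he.corner (star x * y) (mul_mem (star_mem (hmem x hx)) (hmem y hy))
    have h1 : star x * y = c • e := by
      rw [← hc]
      conv_lhs => rw [← hmul x hx, ← hmul y hy]
      rw [star_mul, he.star_eq]
      simp only [mul_assoc]
    rw [hinner, h1, map_smul, inner_smul_right, hφ, hξe, inner_self_eq_norm_sq_to_K, hξ1]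
    simp
  have hinj : ∀ x ∈ leftIdeal N e, φ x = 0 → x = 0 := fun x hx h0 =>
    eq_zero_of_star_mul_self (by rw [hstar x hx x hx, h0, inner_zero_left, zero_smul])
  let V := (leftIdeal N e).map φ
  let b := stdOrthonormalBasis ℂ V
  choose f hfmem hf using fun a => (b a).2
  have hfN : ∀ a, f a ∈ N := fun a => hmem _ (hfmem a)
  refine ⟨_, f, he, hfN, fun a => hmul _ (hfmem a), fun a a' => ?_, fun x hx => ?_⟩
  · rw [hstar _ (hfmem a) _ (hfmem a'), hf, hf, ← Submodule.coe_inner,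
      orthonormal_iff_ite.mp b.orthonormal, ite_smul, one_smul, zero_smul]
  · have hxe : x * e ∈ leftIdeal N e := mul_mem_leftIdeal hx
    have hterm : ∀ a, f a * (star (f a) * (x * e)) = (inner ℂ (φ (f a)) (φ (x * e)) : ℂ) • f a :=
      fun a => by rw [hstar _ (hfmem a) _ hxe, mul_smul_comm, hmul _ (hfmem a)]
    simp only [hterm]
    refine sub_eq_zero.mp (hinj _ (Submodule.sub_mem _ hxe
      (Submodule.sum_mem _ fun a _ => Submodule.smul_mem _ _ (hfmem a))) ?_)
    have h := congrArg Subtype.val (b.sum_repr' ⟨φ (x * e), x * e, hxe, rfl⟩)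
    simp only [Submodule.coe_sum, Submodule.coe_smul, Submodule.coe_inner] at h
    rw [map_sub, map_sum, sub_eq_zero]
    refine h.symm.trans (Finset.sum_congr rfl fun a _ => by rw [map_smul, hf])

end MinimalProj

/-! ### The finite part is a direct sum of full matrix algebras -/

section DirectSum

variable {J : Type u} {n : J → Type} [∀ j, Fintype (n j)] [∀ j, DecidableEq (n j)]
variable {N : StarSubalgebra ℂ (Blocks n)}

theorem IsFrame.proj_mul_star {e : Blocks n} {m : ℕ} {f : Fin m → Blocks n} (h : IsFrame N e f)
    (a : Fin m) : e * star (f a) = star (f a) := by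
  simpa [h.minimal.star_eq] using congrArg star (h.mul_proj a)

/-- The minimal central projection `∑ₐ fₐ fₐ*` of a frame. -/
def frameSum {m : ℕ} (f : Fin m → Blocks n) : Blocks n := ∑ a, f a * star (f a)

theorem IsFrame.frameSum_mul {e : Blocks n} {m : ℕ} {f : Fin m → Blocks n} (h : IsFrame N e f)
    {x : Blocks n} (hx : x ∈ N) (a : Fin m) : frameSum f * (x * f a) = x * f a := by
  have := h.expand (x * f a) (mul_mem hx (h.mem a))
  rw [mul_assoc, h.mul_proj] at this
  rw [frameSum, Finset.sum_mul]
  simp only [mul_assoc]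
  exact this.symm

theorem IsFrame.isCentralProj {e : Blocks n} {m : ℕ} {f : Fin m → Blocks n} (h : IsFrame N e f) :
    IsCentralProj N (frameSum f) := by
  have hstar : star (frameSum f) = frameSum f := by simp [frameSum]
  have hz : ∀ x ∈ N, frameSum f * x * frameSum f = x * frameSum f := by
    intro x hx
    conv_lhs => rw [mul_assoc]; arg 2; rw [frameSum]
    conv_rhs => rw [frameSum]
    simp only [Finset.mul_sum]
    exact Finset.sum_congr rfl fun a _ => by
      rw [← mul_assoc x, ← mul_assoc, h.frameSum_mul hx]
  refine ⟨sum_mem fun a _ => mul_mem (h.mem a) (star_mem (h.mem a)), hstar, ?_, fun x hx => ?_⟩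
  · simpa using hz 1 (one_mem N)
  · have h2 := congrArg star (hz _ (star_mem hx))
    simp only [star_mul, star_star, hstar, ← mul_assoc] at h2
    rw [← hz x hx, h2]

theorem IsFrame.frameSum_ne_zero {e : Blocks n} {m : ℕ} {f : Fin m → Blocks n}
    (h : IsFrame N e f) : frameSum f ≠ 0 := by
  intro h0
  apply h.minimal.ne_zero
  have := h.expand 1 (one_mem N)
  simp only [one_mul, ← mul_assoc] at this
  rw [this, ← Finset.sum_mul]
  change frameSum f * e = 0
  rw [h0, zero_mul]

theorem IsFrame.pos {e : Blocks n} {m : ℕ} {f : Fin m → Blocks n} (h : IsFrame N e f) : 0 < m := by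
  rcases Nat.eq_zero_or_pos m with rfl | h0
  · exact absurd (by simp [frameSum]) h.frameSum_ne_zero
  · exact h0

theorem IsFrame.star_mul_mul {e : Blocks n} {m : ℕ} {f : Fin m → Blocks n} (h : IsFrame N e f)
    {x : Blocks n} (hx : x ∈ N) (a b : Fin m) : ∃ c : ℂ, star (f a) * x * f b = c • e := by
  obtain ⟨c, hc⟩ := h.minimal.corner (star (f a) * x * f b)
    (mul_mem (mul_mem (star_mem (h.mem a)) hx) (h.mem b))
  refine ⟨c, ?_⟩
  rw [← hc, mul_assoc e, mul_assoc _ (f b), h.mul_proj, ← mul_assoc, ← mul_assoc,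
    h.proj_mul_star]

/-- The ideal generated by a minimal projection contains no proper central projection. -/
theorem IsFrame.mul_eq_zero_or {e : Blocks n} {m : ℕ} {f : Fin m → Blocks n} (h : IsFrame N e f)
    {p : Blocks n} (hp : IsCentralProj N p) : p * frameSum f = 0 ∨ p * frameSum f = frameSum f := by
  obtain ⟨c, hc⟩ := h.minimal.corner p hp.mem
  rw [← hp.comm e h.minimal.mem, mul_assoc, h.minimal.mul_self] at hc
  have hf : ∀ a, p * f a = c • f a := fun a => by
    rw [hp.comm _ (h.mem a), ← h.mul_proj a, mul_assoc, ← hp.comm _ h.minimal.mem, hc,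
      mul_smul_comm]
  have hcc : c * c = c := by
    have h1 : (c * c) • e = c • e := by
      rw [mul_smul, ← hc, ← mul_smul_comm, ← hc, ← mul_assoc, hp.mul_self]
    exact smul_left_injective ℂ h.minimal.ne_zero h1
  have hz : p * frameSum f = c • frameSum f := by
    simp only [frameSum, Finset.mul_sum, ← mul_assoc, hf, Finset.smul_sum, smul_mul_assoc]
  rcases IsIdempotentElem.iff_eq_zero_or_one.mp hcc with rfl | rfl
  · exact Or.inl (by rw [hz, zero_smul])
  · exact Or.inr (by rw [hz, one_smul])

/-- The set of minimal central projections of `N`. -/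
def minimalCentralProjs (N : StarSubalgebra ℂ (Blocks n)) : Set (Blocks n) :=
  {z | ∃ (m : ℕ) (e : Blocks n) (f : Fin m → Blocks n), IsFrame N e f ∧ z = frameSum f}

theorem isCentralProj_of_mem {z : Blocks n} (hz : z ∈ minimalCentralProjs N) :
    IsCentralProj N z := by
  obtain ⟨m, e, f, h, rfl⟩ := hz
  exact h.isCentralProj

theorem mul_eq_zero_of_ne {z w : Blocks n} (hz : z ∈ minimalCentralProjs N)
    (hw : w ∈ minimalCentralProjs N) (hne : z ≠ w) : z * w = 0 := by
  have hzc := isCentralProj_of_mem hz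
  have hwc := isCentralProj_of_mem hw
  obtain ⟨m, e, f, h, rfl⟩ := hz
  obtain ⟨m', e', f', h', rfl⟩ := hw
  have hcomm := hzc.comm _ hwc.mem
  rcases h'.mul_eq_zero_or hzc with h0 | h1
  · exact h0
  rcases h.mul_eq_zero_or hwc with h0 | h2
  · rw [hcomm, h0]
  · exact absurd (by rw [← h2, ← hcomm, h1]) hne

/-- A central projection of the finite part is dominated by finitely many minimal ones. -/
theorem exists_finset_dominating (k : ℕ) : ∀ {p : Blocks n}, IsCentralProj N p →
    FiniteDimensional ℂ (leftIdeal N p) → Module.finrank ℂ (leftIdeal N p) = k →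
    ∃ G : Finset (minimalCentralProjs N), ∀ x : Blocks n, (∀ z ∈ G, z.1 * x = 0) → p * x = 0 := by
  classical
  induction k using Nat.strong_induction_on with
  | _ k ih =>
    intro p hp hfd hk
    by_cases h0 : p = 0
    · exact ⟨∅, fun x _ => by rw [h0, zero_mul]⟩
    obtain ⟨e, he, hep⟩ := exists_minimalProj_le k hp.mem hp.star_eq hp.mul_self h0 hfd hk
    obtain ⟨m, f, hf⟩ := exists_frame he
    have hz := hf.isCentralProj
    set z := frameSum f with hzdef
    have hzp : z * p = z := by
      rw [← hp.comm z hz.mem, hzdef, frameSum, Finset.mul_sum]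
      refine Finset.sum_congr rfl fun a _ => ?_
      rw [← mul_assoc, hp.comm _ (hf.mem a), ← hf.mul_proj a, mul_assoc (f a), hep]
    have hpz : p * z = z := by rw [hp.comm z hz.mem, hzp]
    have hp' : IsCentralProj N (p - z) :=
      { mem := sub_mem hp.mem hz.mem
        star_eq := by rw [star_sub, hp.star_eq, hz.star_eq]
        mul_self := by simp [mul_sub, sub_mul, hp.mul_self, hz.mul_self, hzp, hpz]
        comm := fun x hx => by rw [sub_mul, mul_sub, hp.comm x hx, hz.comm x hx] }
    have hlt : leftIdeal N (p - z) < leftIdeal N p := by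
      refine lt_of_le_of_ne ?_ fun h => ?_
      · rintro _ ⟨y, hy, rfl⟩
        refine mem_leftIdeal.mpr ⟨y * (p - z), mul_mem hy hp'.mem, ?_⟩
        rw [LinearMap.mulRight_apply, mul_assoc, sub_mul, hp.mul_self, hzp]
      · have hmem : z ∈ leftIdeal N p := mem_leftIdeal.mpr ⟨z, hz.mem, hzp⟩
        rw [← h] at hmem
        obtain ⟨y, hy, hyz⟩ := hmem
        have hyz : y * (p - z) = z := hyz
        apply hf.frameSum_ne_zero
        rw [← hzdef, ← hz.mul_self]
        nth_rw 1 [← hyz]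
        rw [mul_assoc, sub_mul, hpz, hz.mul_self, sub_self, mul_zero]
    obtain ⟨G, hG⟩ := ih _ (hk ▸ Submodule.finrank_lt_finrank_of_lt hlt) hp'
      (Submodule.finiteDimensional_of_le hlt.le) rfl
    refine ⟨insert ⟨z, m, e, f, hf, hzdef⟩ G, fun x hx => ?_⟩
    have h1 : z * x = 0 := hx ⟨z, m, e, f, hf, hzdef⟩ (Finset.mem_insert_self _ _)
    have h2 := hG x fun w hw => hx w (Finset.mem_insert_of_mem hw)
    rwa [sub_mul, h1, sub_zero] at h2

theorem minimalCentralProjs_subset (hN : IsBlockClosed N) {z : Blocks n}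
    (hz : z ∈ minimalCentralProjs N) : z ∈ finitePart N := by
  have hzc := isCentralProj_of_mem hz
  obtain ⟨m, e, f, h, rfl⟩ := hz
  obtain ⟨j, hj⟩ : ∃ j, frameSum f j ≠ 0 := Function.ne_iff.mp h.frameSum_ne_zero
  -- a local unit that is `1` on a block where `z` does not vanish dominates `z`
  obtain ⟨p, hp, hpB, hp1, -⟩ := exists_central_local_unit hN {j}
  rcases h.mul_eq_zero_or hp with h0 | h1
  · refine absurd ?_ hj
    have := congrFun h0 j
    rwa [Pi.mul_apply, hp1 j (Finset.mem_singleton_self j), one_mul] at this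
  · rw [← h1]
    exact finitePart_mul_mem hzc.mem hpB

/-- The matrix of `x` with respect to a frame, `τ` being a functional with `τ e = 1`. -/
def frameMatrix {m : ℕ} (f : Fin m → Blocks n) (τ : Blocks n →ₗ[ℂ] ℂ) (x : Blocks n) :
    Matrix (Fin m) (Fin m) ℂ := Matrix.of fun a b => τ (star (f a) * x * f b)

theorem IsFrame.frameMatrix_smul {e : Blocks n} {m : ℕ} {f : Fin m → Blocks n} (h : IsFrame N e f)
    {τ : Blocks n →ₗ[ℂ] ℂ} (hτ : τ e = 1) {x : Blocks n} (hx : x ∈ N) (a b : Fin m) :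
    frameMatrix f τ x a b • e = star (f a) * x * f b := by
  obtain ⟨c, hc⟩ := h.star_mul_mul hx a b
  rw [frameMatrix, Matrix.of_apply, hc, map_smul, hτ, smul_eq_mul, mul_one]

theorem IsFrame.frameMatrix_eq_iff {e : Blocks n} {m : ℕ} {f : Fin m → Blocks n}
    (h : IsFrame N e f) {τ : Blocks n →ₗ[ℂ] ℂ} (hτ : τ e = 1) {x : Blocks n} (hx : x ∈ N)
    (a b : Fin m) (c : ℂ) : frameMatrix f τ x a b = c ↔ star (f a) * x * f b = c • e := by
  rw [← h.frameMatrix_smul hτ hx]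
  exact ⟨fun h => by rw [h], fun h' => smul_left_injective ℂ h.minimal.ne_zero h'⟩

theorem IsFrame.frameMatrix_mul {e : Blocks n} {m : ℕ} {f : Fin m → Blocks n} (h : IsFrame N e f)
    {τ : Blocks n →ₗ[ℂ] ℂ} (hτ : τ e = 1) {x y : Blocks n} (hx : x ∈ N) (hy : y ∈ N) :
    frameMatrix f τ (x * y) = frameMatrix f τ x * frameMatrix f τ y := by
  ext a b
  rw [h.frameMatrix_eq_iff hτ (mul_mem hx hy), Matrix.mul_apply, Finset.sum_smul]
  have h1 : star (f a) * (x * y) * f b = star (f a) * x * (frameSum f * (y * f b)) := by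
    rw [h.frameSum_mul hy]
    simp only [mul_assoc]
  rw [h1, frameSum, Finset.sum_mul, Finset.mul_sum]
  refine Finset.sum_congr rfl fun c _ => ?_
  have h2 : star (f a) * x * (f c * star (f c) * (y * f b)) =
      (star (f a) * x * f c) * (star (f c) * y * f b) := by simp only [mul_assoc]
  rw [h2, mul_smul, h.frameMatrix_smul hτ hy, ← h.frameMatrix_smul hτ hx a c, smul_mul_assoc,
    ← mul_assoc, ← mul_assoc, h.proj_mul_star]

theorem IsFrame.frameMatrix_star {e : Blocks n} {m : ℕ} {f : Fin m → Blocks n} (h : IsFrame N e f)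
    {τ : Blocks n →ₗ[ℂ] ℂ} (hτ : τ e = 1) {x : Blocks n} (hx : x ∈ N) :
    frameMatrix f τ (star x) = star (frameMatrix f τ x) := by
  ext a b
  rw [h.frameMatrix_eq_iff hτ (star_mem hx), Matrix.star_apply]
  have := congrArg star (h.frameMatrix_smul hτ hx b a)
  rw [star_smul, h.minimal.star_eq] at this
  rw [this]
  simp only [star_mul, star_star, mul_assoc]

theorem IsFrame.frameSum_mul_eq {e : Blocks n} {m : ℕ} {f : Fin m → Blocks n} (h : IsFrame N e f)
    {τ : Blocks n →ₗ[ℂ] ℂ} (hτ : τ e = 1) {x : Blocks n} (hx : x ∈ N) :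
    frameSum f * x = ∑ a, ∑ b, frameMatrix f τ x a b • (f a * star (f b)) := by
  have hz := h.isCentralProj
  rw [← hz.mul_self, mul_assoc, hz.comm x hx, ← mul_assoc]
  conv_lhs => rw [frameSum]
  rw [Finset.sum_mul, Finset.sum_mul]
  refine Finset.sum_congr rfl fun a _ => ?_
  rw [Finset.mul_sum]
  refine Finset.sum_congr rfl fun b _ => ?_
  have h1 : f a * star (f a) * x * (f b * star (f b)) =
      f a * (star (f a) * x * f b) * star (f b) := by simp only [mul_assoc]
  rw [h1, ← h.frameMatrix_smul hτ hx, mul_smul_comm, smul_mul_assoc, h.mul_proj]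

theorem IsFrame.mul_star_mem {e : Blocks n} {m : ℕ} {f : Fin m → Blocks n} (h : IsFrame N e f)
    (a b : Fin m) : f a * star (f b) ∈ N := mul_mem (h.mem a) (star_mem (h.mem b))

theorem IsFrame.frameSum_mul_self {e : Blocks n} {m : ℕ} {f : Fin m → Blocks n}
    (h : IsFrame N e f) (a : Fin m) : frameSum f * f a = f a := by
  simpa using h.frameSum_mul (one_mem N) a

theorem IsFrame.star_mul_eq_zero {e e' : Blocks n} {m m' : ℕ} {f : Fin m → Blocks n}
    {f' : Fin m' → Blocks n} (h : IsFrame N e f) (h' : IsFrame N e' f')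
    (hne : frameSum f ≠ frameSum f') (a : Fin m) (b : Fin m') : star (f a) * f' b = 0 := by
  have h0 := mul_eq_zero_of_ne ⟨m, e, f, h, rfl⟩ ⟨m', e', f', h', rfl⟩ hne
  have h1 : star (f a) * frameSum f = star (f a) := by
    simpa [h.isCentralProj.star_eq] using congrArg star (h.frameSum_mul_self a)
  rw [← h1, ← h'.frameSum_mul_self b, mul_assoc, ← mul_assoc (frameSum f), h0, zero_mul, mul_zero]

/-- A direct sum of full matrix algebras, indexed by the minimal central projections, is identified
with the finite part by matrix units coming from frames. -/
theorem exists_starAlgEquiv_finSupp (hN : IsBlockClosed N) :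
    ∃ (L : Type u) (m : L → ℕ), (∀ l, 0 < m l) ∧
      Nonempty (finitePart N ≃⋆ₐ[ℂ] finSupp fun l => Fin (m l)) := by
  classical
  have hL : ∀ l : minimalCentralProjs N, ∃ (m : ℕ) (e : Blocks n) (f : Fin m → Blocks n)
      (τ : Blocks n →ₗ[ℂ] ℂ), IsFrame N e f ∧ l.1 = frameSum f ∧ τ e = 1 := by
    rintro ⟨z, m, e, f, h, hz⟩
    obtain ⟨τ, hτ⟩ := Module.Projective.exists_dual_eq_one ℂ h.minimal.ne_zero
    exact ⟨m, e, f, τ, h, hz, hτ⟩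
  choose m e f τ hf hz hτ using hL
  have hfin : ∀ b ∈ finitePart N, {l | frameMatrix (f l) (τ l) b ≠ 0}.Finite := by
    intro b hb
    obtain ⟨p, hp, hpB, hpb, -⟩ := exists_central_unit_of_mem hN hb
    obtain ⟨G, hG⟩ := exists_finset_dominating _ hp (finiteDimensional_leftIdeal hN hpB) rfl
    -- `b` is supported on the finitely many minimal central projections dominating its unit `p`
    refine G.finite_toSet.subset fun l hl => ?_
    by_contra hlG
    apply hl
    have h0 : p * l.1 = 0 := hG _ fun z hzG =>
      mul_eq_zero_of_ne z.2 l.2 fun h => hlG (by rwa [← Subtype.ext h])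
    ext a c
    rw [(hf l).frameMatrix_eq_iff (hτ l) hb.1, Matrix.zero_apply, zero_smul, mul_assoc,
      ← (hf l).frameSum_mul hb.1, ← hz, ← hpb]
    simp only [← mul_assoc]
    rw [mul_assoc (star _), ← hp.comm _ (isCentralProj_of_mem l.2).mem, h0]
    simp
  let Φ : finitePart N →⋆ₙₐ[ℂ] finSupp fun l => Fin (m l) :=
    { toFun := fun b => ⟨fun l => frameMatrix (f l) (τ l) b, hfin b b.2⟩
      map_smul' := fun c x => Subtype.ext (funext fun l => by
        ext a b
        simp [frameMatrix])
      map_zero' := Subtype.ext (funext fun l => by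
        ext a b
        simp [frameMatrix])
      map_add' := fun x y => Subtype.ext (funext fun l => by
        ext a b
        simp [frameMatrix, mul_add, add_mul])
      map_mul' := fun x y => Subtype.ext (funext fun l =>
        (hf l).frameMatrix_mul (hτ l) x.2.1 y.2.1)
      map_star' := fun x => Subtype.ext (funext fun l =>
        (hf l).frameMatrix_star (hτ l) x.2.1) }
  refine ⟨minimalCentralProjs N, m, fun l => (hf l).pos,
    ⟨StarAlgEquiv.ofBijective Φ ⟨(injective_iff_map_eq_zero Φ).mpr fun b hb => ?_, fun y => ?_⟩⟩⟩
  · obtain ⟨p, hp, hpB, hpb, -⟩ := exists_central_unit_of_mem hN b.2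
    obtain ⟨G, hG⟩ := exists_finset_dominating _ hp (finiteDimensional_leftIdeal hN hpB) rfl
    refine Subtype.ext (hpb.symm.trans (hG _ fun l _ => ?_))
    have h0 : frameMatrix (f l) (τ l) b.1 = 0 := congrFun (congrArg Subtype.val hb) l
    rw [hz, (hf l).frameSum_mul_eq (hτ l) b.2.1, h0]
    simp
  · let x : Blocks n := ∑ l ∈ y.2.toFinset, ∑ a, ∑ b, y.1 l a b • (f l a * star (f l b))
    have hx : x ∈ finitePart N := by
      refine sum_mem fun l _ => sum_mem fun a _ => sum_mem fun b _ =>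
        (finitePart N).smul_mem' _ ?_
      rw [← (hf l).frameSum_mul_self, mul_assoc]
      exact finitePart_mul_mem ((hf l).mul_star_mem a b)
        (minimalCentralProjs_subset hN ⟨_, _, _, hf l, rfl⟩)
    refine ⟨⟨x, hx⟩, Subtype.ext (funext fun l => ?_)⟩
    change frameMatrix (f l) (τ l) x = y.1 l
    ext a b
    rw [(hf l).frameMatrix_eq_iff (hτ l) hx.1]
    simp only [x, Finset.mul_sum, Finset.sum_mul]
    rw [Finset.sum_eq_single l]
    · have hterm : ∀ a' b', star (f l a) * (y.1 l a' b' • (f l a' * star (f l b'))) * f l b =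
          if a = a' then if b' = b then y.1 l a' b' • e l else 0 else 0 := by
        intro a' b'
        rw [mul_smul_comm, smul_mul_assoc, mul_assoc, mul_assoc, (hf l).orthonormal, ← mul_assoc,
          (hf l).orthonormal]
        by_cases h1 : a = a' <;> by_cases h2 : b' = b <;> simp [h1, h2, (hf l).minimal.mul_self]
      simp only [hterm]
      simp
    · intro l' _ hll
      have hne : frameSum (f l) ≠ frameSum (f l') := fun h =>
        hll (Subtype.ext (by rw [hz, hz, h]))
      refine Finset.sum_eq_zero fun a' _ => Finset.sum_eq_zero fun b' _ => ?_
      rw [mul_smul_comm, smul_mul_assoc, ← mul_assoc, (hf l).star_mul_eq_zero (hf l') hne]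
      simp
    · intro hl
      have h0 : y.1 l = 0 := by
        by_contra h
        exact hl (y.2.mem_toFinset.mpr h)
      simp [h0]

end DirectSum

/-! ### Legs and slices -/

section Legs

variable {I : Type u} {d : I → ℕ}

/-- The span of the slices `(ω ⊗ ι)(X)`, `ω ∈ Â`. -/
def leftLeg (X : M₂ d) : Submodule ℂ (M d) :=
  Submodule.span ℂ {x | ∃ i a a', x = coeff₂ X i a a'}

/-- The span of the slices `(ι ⊗ η)(X)`, `η ∈ Â`. -/
def rightLeg (X : M₂ d) : Submodule ℂ (M d) :=
  Submodule.span ℂ {x | ∃ j b b', x = coeff₁ X j b b'}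

theorem coeff₂_mem_leftLeg (X : M₂ d) (i : I) (a a' : Fin (d i)) : coeff₂ X i a a' ∈ leftLeg X :=
  Submodule.subset_span ⟨i, a, a', rfl⟩

theorem coeff₁_mem_rightLeg (X : M₂ d) (j : I) (b b' : Fin (d j)) :
    coeff₁ X j b b' ∈ rightLeg X :=
  Submodule.subset_span ⟨j, b, b', rfl⟩

/-- The matrix coefficient `x ↦ (x i) a a'`. -/
def entry (i : I) (a a' : Fin (d i)) : Module.Dual ℂ (M d) where
  toFun x := x i a a'
  map_add' _ _ := rfl
  map_smul' _ _ := rfl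

theorem entry_mem_dual (i : I) (a a' : Fin (d i)) : entry i a a' ∈ dual d :=
  ⟨{i}, fun x hx => by
    change x i a a' = 0
    rw [hx i (Finset.mem_singleton_self i), Matrix.zero_apply]⟩

/-- `Â` is spanned by the matrix coefficients. -/
theorem dual_eq_span : dual d = Submodule.span ℂ {ω | ∃ i a a', ω = entry (d := d) i a a'} := by
  classical
  refine le_antisymm ?_ (Submodule.span_le.mpr ?_)
  · rintro ω ⟨F, hF⟩
    have h : ω = ∑ i ∈ F, ∑ a, ∑ a', ω (Pi.single i (Matrix.single a a' 1)) • entry i a a' := by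
      ext x
      have h0 := hF (x - ∑ i ∈ F, Pi.single i (x i)) fun i hi => by
        rw [Pi.sub_apply, Finset.sum_apply, Finset.sum_eq_single i]
        · simp
        · intro j _ hj
          exact Pi.single_eq_of_ne hj.symm _
        · exact fun h => absurd hi h
      rw [map_sub, sub_eq_zero, map_sum] at h0
      rw [h0, LinearMap.sum_apply]
      refine Finset.sum_congr rfl fun i _ => ?_
      have h1 : (Pi.single i (x i) : M d) =
          ∑ a, ∑ a', x i a a' • (Pi.single i (Matrix.single a a' 1) : M d) := by
        conv_lhs => rw [Matrix.matrix_eq_sum_single (x i)]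
        simp only [← Pi.single_smul, Matrix.smul_single, smul_eq_mul, mul_one]
        rw [← LinearMap.single_apply (R := ℂ) (φ := fun i => Matrix (Fin (d i)) (Fin (d i)) ℂ),
          map_sum]
        simp only [map_sum, LinearMap.single_apply]
      rw [h1]
      simp only [map_sum, map_smul, LinearMap.sum_apply, LinearMap.smul_apply, smul_eq_mul]
      exact Finset.sum_congr rfl fun a _ => Finset.sum_congr rfl fun a' _ => mul_comm _ _
    rw [h]
    exact Submodule.sum_mem _ fun i _ => Submodule.sum_mem _ fun a _ => Submodule.sum_mem _
      fun a' _ => Submodule.smul_mem _ _ (Submodule.subset_span ⟨i, a, a', rfl⟩)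
  · rintro _ ⟨i, a, a', rfl⟩
    exact entry_mem_dual i a a'

theorem sliceLeft_mem_leftLeg {ω : Module.Dual ℂ (M d)} (hω : ω ∈ dual d) (X : M₂ d) :
    sliceLeft ω X ∈ leftLeg X := by
  rw [dual_eq_span] at hω
  induction hω using Submodule.span_induction with
  | mem ω h =>
    obtain ⟨i, a, a', rfl⟩ := h
    exact coeff₂_mem_leftLeg X i a a'
  | zero => exact (leftLeg X).zero_mem
  | add ω η _ _ h h' => exact (leftLeg X).add_mem h h'
  | smul c ω _ h => exact (leftLeg X).smul_mem c h

theorem sliceRight_mem_rightLeg {ω : Module.Dual ℂ (M d)} (hω : ω ∈ dual d) (X : M₂ d) :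
    sliceRight ω X ∈ rightLeg X := by
  rw [dual_eq_span] at hω
  induction hω using Submodule.span_induction with
  | mem ω h =>
    obtain ⟨i, a, a', rfl⟩ := h
    exact coeff₁_mem_rightLeg X i a a'
  | zero => exact (rightLeg X).zero_mem
  | add ω η _ _ h h' => exact (rightLeg X).add_mem h h'
  | smul c ω _ h => exact (rightLeg X).smul_mem c h

theorem mem_leftLeg_of_eq {ω : Module.Dual ℂ (M d)} (hω : ω ∈ dual d) {X : M₂ d} {x : M d}
    (h : ∀ j b b', x j b b' = ω (coeff₁ X j b b')) : x ∈ leftLeg X := by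
  have hx : x = sliceLeft ω X := funext fun j => Matrix.ext fun b b' => h j b b'
  rw [hx]
  exact sliceLeft_mem_leftLeg hω X

theorem mem_rightLeg_of_eq {ω : Module.Dual ℂ (M d)} (hω : ω ∈ dual d) {X : M₂ d} {x : M d}
    (h : ∀ i a a', x i a a' = ω (coeff₂ X i a a')) : x ∈ rightLeg X := by
  have hx : x = sliceRight ω X := funext fun i => Matrix.ext fun a a' => h i a a'
  rw [hx]
  exact sliceRight_mem_rightLeg hω X

theorem sliceSpan_eq (X : M₂ d) : sliceSpan X = leftLeg X * rightLeg X := by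
  refine le_antisymm (Submodule.span_le.mpr ?_) ?_
  · rintro _ ⟨ω, hω, η, hη, rfl⟩
    exact Submodule.mul_mem_mul (sliceLeft_mem_leftLeg hω X) (sliceRight_mem_rightLeg hη X)
  · rw [leftLeg, rightLeg, Submodule.span_mul_span]
    refine Submodule.span_mono ?_
    rintro _ ⟨_, ⟨i, a, a', rfl⟩, _, ⟨j, b, b', rfl⟩, rfl⟩
    exact ⟨entry i a a', entry_mem_dual i a a', entry j b b', entry_mem_dual j b b', rfl⟩

/-- The block `i` of the first leg of `X`, as a matrix over `M(A)`. -/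
def legMatrix₂ (X : M₂ d) (i : I) : Matrix (Fin (d i)) (Fin (d i)) (M d) :=
  Matrix.of (coeff₂ X i)

/-- The block `j` of the second leg of `X`, as a matrix over `M(A)`. -/
def legMatrix₁ (X : M₂ d) (j : I) : Matrix (Fin (d j)) (Fin (d j)) (M d) :=
  Matrix.of (coeff₁ X j)

theorem coeff₂_mul (X Y : M₂ d) (i : I) (a a' : Fin (d i)) :
    coeff₂ (X * Y) i a a' = ∑ α, coeff₂ X i a α * coeff₂ Y i α a' := by
  funext j
  ext b b'
  simp [coeff₂, Matrix.mul_apply, Fintype.sum_prod_type, Matrix.sum_apply]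

theorem coeff₁_mul (X Y : M₂ d) (j : I) (b b' : Fin (d j)) :
    coeff₁ (X * Y) j b b' = ∑ β, coeff₁ X j b β * coeff₁ Y j β b' := by
  funext i
  ext a a'
  simp only [coeff₁, Pi.mul_apply, Matrix.of_apply, Matrix.mul_apply, Fintype.sum_prod_type,
    Finset.sum_apply, Matrix.sum_apply]
  exact Finset.sum_comm

theorem coeff₂_one (i : I) (a a' : Fin (d i)) :
    coeff₂ (1 : M₂ d) i a a' = if a = a' then 1 else 0 := by
  funext j
  ext b b'
  by_cases h : a = a' <;> simp [coeff₂, Matrix.one_apply, h]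

theorem coeff₁_one (j : I) (b b' : Fin (d j)) :
    coeff₁ (1 : M₂ d) j b b' = if b = b' then 1 else 0 := by
  funext i
  ext a a'
  by_cases h : b = b' <;> simp [coeff₁, Matrix.one_apply, h]

theorem legMatrix₂_mul (X Y : M₂ d) (i : I) :
    legMatrix₂ (X * Y) i = legMatrix₂ X i * legMatrix₂ Y i := by
  ext1 a a'
  rw [Matrix.mul_apply]
  exact coeff₂_mul X Y i a a'

theorem legMatrix₁_mul (X Y : M₂ d) (j : I) :
    legMatrix₁ (X * Y) j = legMatrix₁ X j * legMatrix₁ Y j := by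
  ext1 a a'
  rw [Matrix.mul_apply]
  exact coeff₁_mul X Y j a a'

theorem legMatrix₂_one (i : I) : legMatrix₂ (1 : M₂ d) i = 1 := by
  ext1 a a'
  rw [Matrix.one_apply]
  exact coeff₂_one i a a'

theorem legMatrix₁_one (j : I) : legMatrix₁ (1 : M₂ d) j = 1 := by
  ext1 a a'
  rw [Matrix.one_apply]
  exact coeff₁_one j a a'

theorem tmul_mul_tmul (x y x' y' : M d) : tmul x y * tmul x' y' = tmul (x * x') (y * y') :=
  funext fun _ => (Matrix.mul_kronecker_mul _ _ _ _).symm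

/-- The bilinear map `(x, y) ↦ x ⊗ y`. -/
def tmulₗ : M d →ₗ[ℂ] M d →ₗ[ℂ] M₂ d :=
  LinearMap.mk₂ ℂ tmul
    (fun _ _ _ => funext fun _ => Matrix.add_kronecker _ _ _)
    (fun c x y => funext fun _ => by simp [tmul, Matrix.smul_kronecker])
    (fun _ _ _ => funext fun _ => Matrix.kronecker_add _ _ _)
    (fun c x y => funext fun _ => by simp [tmul, Matrix.kronecker_smul])

theorem tmul_mem_tensor {V W : Submodule ℂ (M d)} {x y : M d} (hx : x ∈ V) (hy : y ∈ W) :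
    tmul x y ∈ tensor V W := Submodule.subset_span ⟨x, hx, y, hy, rfl⟩

theorem tensor_mono {V W V' W' : Submodule ℂ (M d)} (hV : V ≤ V') (hW : W ≤ W') :
    tensor V W ≤ tensor V' W' :=
  Submodule.span_mono fun _ ⟨x, hx, y, hy, h⟩ => ⟨x, hV hx, y, hW hy, h⟩

theorem tensor_eq_map₂ (V W : Submodule ℂ (M d)) : tensor V W = Submodule.map₂ tmulₗ V W := by
  refine le_antisymm (Submodule.span_le.mpr ?_) (Submodule.map₂_le.mpr fun x hx y hy => ?_)
  · rintro _ ⟨x, hx, y, hy, rfl⟩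
    exact Submodule.apply_mem_map₂ tmulₗ hx hy
  · exact tmul_mem_tensor hx hy

theorem finiteDimensional_tensor (V W : Submodule ℂ (M d)) [FiniteDimensional ℂ V]
    [FiniteDimensional ℂ W] : FiniteDimensional ℂ (tensor V W) := by
  rw [tensor_eq_map₂]
  exact Module.Finite.iff_fg.mpr (Submodule.FG.map₂ _ (Module.Finite.iff_fg.mp inferInstance)
    (Module.Finite.iff_fg.mp inferInstance))

theorem tensor_mul_tensor_le (V W V' W' : Submodule ℂ (M d)) :
    tensor V W * tensor V' W' ≤ tensor (V * V') (W * W') := by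
  rw [tensor, tensor, Submodule.span_mul_span, Submodule.span_le]
  rintro _ ⟨_, ⟨x, hx, y, hy, rfl⟩, _, ⟨x', hx', y', hy', rfl⟩, rfl⟩
  change tmul x y * tmul x' y' ∈ _
  rw [tmul_mul_tmul]
  exact tmul_mem_tensor (Submodule.mul_mem_mul hx hx') (Submodule.mul_mem_mul hy hy')

theorem coeff₁_tmul (x y : M d) (j : I) (b b' : Fin (d j)) :
    coeff₁ (tmul x y) j b b' = y j b b' • x := by
  funext i
  ext a a'
  simp [coeff₁, tmul, mul_comm]

theorem coeff₂_tmul (x y : M d) (i : I) (a a' : Fin (d i)) :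
    coeff₂ (tmul x y) i a a' = x i a a' • y := by
  funext j
  ext b b'
  simp [coeff₂, tmul]

theorem coeff₁_sum {κ : Type*} (s : Finset κ) (X : κ → M₂ d) (j : I) (b b' : Fin (d j)) :
    coeff₁ (∑ k ∈ s, X k) j b b' = ∑ k ∈ s, coeff₁ (X k) j b b' := by
  funext i
  ext a a'
  simp [coeff₁, Matrix.sum_apply]

theorem coeff₂_sum {κ : Type*} (s : Finset κ) (X : κ → M₂ d) (i : I) (a a' : Fin (d i)) :
    coeff₂ (∑ k ∈ s, X k) i a a' = ∑ k ∈ s, coeff₂ (X k) i a a' := by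
  funext j
  ext b b'
  simp [coeff₂, Matrix.sum_apply]

theorem sliceLeft_sum_tmul {κ : Type*} (s : Finset κ) (ω : M d →ₗ[ℂ] ℂ) (x y : κ → M d) :
    sliceLeft ω (∑ k ∈ s, tmul (x k) (y k)) = ∑ k ∈ s, ω (x k) • y k := by
  funext j
  ext b b'
  simp [sliceLeft, coeff₁_sum, coeff₁_tmul, Matrix.sum_apply, mul_comm]

theorem mulMapLeft_sum_tmul {κ : Type*} (s : Finset κ) (S : M d →ₗ[ℂ] M d) (x y : κ → M d) :
    mulMapLeft S (∑ k ∈ s, tmul (x k) (y k)) = ∑ k ∈ s, S (x k) * y k := by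
  funext j
  ext b b'
  simp only [mulMapLeft, coeff₁_sum, coeff₁_tmul, map_sum, map_smul, Finset.sum_apply,
    Matrix.of_apply, Matrix.sum_apply, Pi.smul_apply, Matrix.smul_apply, Pi.mul_apply,
    Matrix.mul_apply, smul_eq_mul]
  rw [Finset.sum_comm]
  simp only [mul_comm]

theorem mulMapRight_sum_tmul {κ : Type*} (s : Finset κ) (S : M d →ₗ[ℂ] M d) (x y : κ → M d) :
    mulMapRight S (∑ k ∈ s, tmul (x k) (y k)) = ∑ k ∈ s, x k * S (y k) := by
  funext j
  ext b b'
  simp only [mulMapRight, coeff₂_sum, coeff₂_tmul, map_sum, map_smul, Finset.sum_apply,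
    Matrix.of_apply, Matrix.sum_apply, Pi.smul_apply, Matrix.smul_apply, Pi.mul_apply,
    Matrix.mul_apply, smul_eq_mul]
  rw [Finset.sum_comm]

end Legs

/-! ### Locality of the structure maps -/

section Locality

variable {I : Type u} {d : I → ℕ} (A : DiscreteHopfStarAlgebra d)

/-- Each block of `Δ(x)` depends on finitely many blocks of `x`. -/
theorem comul_local (p : I × I) :
    ∃ F : Finset I, ∀ x : M d, (∀ i ∈ F, x i = 0) → A.comul x p = 0 := by
  classical
  have h1 : (Pi.single p 1 : M₂ d) ∈ (alg₂ d).toSubmodule :=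
    (Set.finite_singleton p).subset fun q hq => by
      by_contra h
      exact hq (Pi.single_eq_of_ne h _)
  rw [← A.comul_nondegenerate] at h1
  have key : ∀ y ∈ Submodule.span ℂ {y : M₂ d | ∃ a ∈ alg d, ∃ t ∈ alg₂ d, y = A.comul a * t},
      ∃ F : Finset I, ∀ x : M d, (∀ i ∈ F, x i = 0) → A.comul x * y = 0 := by
    intro y hy
    induction hy using Submodule.span_induction with
    | mem y h =>
      obtain ⟨a, ha, t, -, rfl⟩ := h
      refine ⟨ha.toFinset, fun x hx => ?_⟩
      have h0 : x * a = 0 := funext fun i => by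
        by_cases hi : a i = 0
        · rw [Pi.mul_apply, hi, mul_zero, Pi.zero_apply]
        · rw [Pi.mul_apply, hx i (ha.mem_toFinset.mpr hi), zero_mul, Pi.zero_apply]
      rw [← mul_assoc, ← map_mul, h0, map_zero, zero_mul]
    | zero => exact ⟨∅, fun x _ => mul_zero _⟩
    | add y z _ _ hy hz =>
      obtain ⟨F, hF⟩ := hy
      obtain ⟨G, hG⟩ := hz
      refine ⟨F ∪ G, fun x hx => ?_⟩
      rw [mul_add, hF x fun i hi => hx i (Finset.mem_union_left _ hi),
        hG x fun i hi => hx i (Finset.mem_union_right _ hi), add_zero]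
    | smul c y _ hy =>
      obtain ⟨F, hF⟩ := hy
      exact ⟨F, fun x hx => by rw [mul_smul_comm, hF x hx, smul_zero]⟩
  obtain ⟨F, hF⟩ := key _ h1
  refine ⟨F, fun x hx => ?_⟩
  have := congrFun (hF x hx) p
  rwa [Pi.mul_apply, Pi.single_eq_same, mul_one] at this

theorem comul_local_finset (G : Finset (I × I)) :
    ∃ F : Finset I, ∀ x : M d, (∀ i ∈ F, x i = 0) → ∀ p ∈ G, A.comul x p = 0 := by
  classical
  choose F hF using comul_local A
  exact ⟨G.biUnion F, fun x hx p hp => hF p x fun i hi => hx i (Finset.mem_biUnion.mpr ⟨p, hp, hi⟩)⟩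

theorem counit_mem_dual : A.counit.toLinearMap ∈ dual d := by
  obtain ⟨a, ha, ha0⟩ := A.counit_nondegenerate
  refine ⟨ha.toFinset, fun x hx => ?_⟩
  have h0 : x * a = 0 := funext fun i => by
    by_cases hi : a i = 0
    · rw [Pi.mul_apply, hi, mul_zero, Pi.zero_apply]
    · rw [Pi.mul_apply, hx i (ha.mem_toFinset.mpr hi), zero_mul, Pi.zero_apply]
  have := congrArg A.counit h0
  rw [map_mul, map_zero] at this
  exact (mul_eq_zero.mp this).resolve_right ha0

/-- The minimal central projection `1ᵢ` of `M(A)`. -/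
noncomputable def blockUnit (i : I) : M d := by
  classical
  exact Pi.single i 1

theorem blockUnit_mul (i : I) (x : M d) : blockUnit i * x = x * blockUnit i := by
  classical
  funext j
  by_cases h : j = i
  · subst h
    simp [blockUnit]
  · simp [blockUnit, Pi.single_eq_of_ne h]

theorem blockUnit_apply (i : I) : (blockUnit i : M d) i = 1 := by
  simp [blockUnit]

theorem blockUnit_mul_self (i : I) : (blockUnit i * blockUnit i : M d) = blockUnit i := by
  simp [blockUnit, ← Pi.single_mul]

theorem blockUnit_mul_eq_zero {i : I} {x : M d} : blockUnit i * x = 0 ↔ x i = 0 := by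
  classical
  refine ⟨fun h => ?_, fun h => funext fun j => ?_⟩
  · have := congrFun h i
    rwa [Pi.mul_apply, blockUnit_apply, one_mul] at this
  · by_cases hj : j = i
    · subst hj
      simp [h]
    · simp [blockUnit, Pi.single_eq_of_ne hj]

/-- An anti-automorphism of `M(A)` permutes the blocks: the central idempotent `S(1ⱼ)` is `0` or `1`
in each block, and in a given block it is `1` for some `j`. -/
theorem antiAut_local (S : M d ≃ₗ[ℂ] M d) (hS : ∀ x y, S (x * y) = S y * S x) (i : I) :
    ∃ F : Finset I, ∀ x : M d, (∀ j ∈ F, x j = 0) → S x i = 0 := by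
  by_cases h1 : (blockUnit i : M d) = 0
  · refine ⟨∅, fun x _ => ?_⟩
    have h2 := congrFun h1 i
    rw [blockUnit_apply] at h2
    rw [← mul_one (S x i), h2]
    exact mul_zero _
  have hz : S.symm (blockUnit i) ≠ 0 := fun h => h1 (S.symm.map_eq_zero_iff.mp h)
  obtain ⟨j, hj⟩ := Function.ne_iff.mp hz
  have hne : S (blockUnit j) i ≠ 0 := fun h => by
    have h2 := blockUnit_mul_eq_zero.mpr h
    have h3 : S (blockUnit j * S.symm (blockUnit i)) = 0 := by
      rw [hS, LinearEquiv.apply_symm_apply, h2]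
    exact hj (blockUnit_mul_eq_zero.mp (S.map_eq_zero_iff.mp h3))
  have hcomm : ∀ y, Commute (S (blockUnit j)) y := fun y => by
    obtain ⟨x, rfl⟩ := S.surjective y
    rw [commute_iff_eq, ← hS, ← hS, blockUnit_mul]
  have hidem : S (blockUnit j) i * S (blockUnit j) i = S (blockUnit j) i := by
    rw [← Pi.mul_apply, ← hS]
    rw [blockUnit_mul_self]
  have hone : S (blockUnit j) i = 1 := by
    classical
    have hc : S (blockUnit j) i ∈ Set.range (Matrix.scalar (Fin (d i)) : ℂ →+* _) := by
      rw [Matrix.mem_range_scalar_iff_commute_single']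
      intro a b
      have := congrFun (hcomm (Pi.single i (Matrix.single a b 1))) i
      rw [Pi.mul_apply, Pi.mul_apply, Pi.single_eq_same] at this
      exact this.symm
    obtain ⟨c, hc⟩ := hc
    have hcc : (Matrix.scalar (Fin (d i))) (c * (c - 1)) = 0 := by
      rw [mul_sub, mul_one, map_sub, map_mul, hc, hidem, sub_self]
    have hc0 : c ≠ 0 := fun h => hne (by rw [← hc, h, map_zero])
    have : (Matrix.scalar (Fin (d i))) (c - 1) = 0 := by
      have h := congrArg (fun x => c⁻¹ • x) hcc
      simpa [Matrix.smul_eq_diagonal_mul, hc0] using h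
    rw [map_sub, map_one, sub_eq_zero, hc] at this
    exact this
  refine ⟨{j}, fun x hx => ?_⟩
  have h4 : blockUnit j * x = 0 := blockUnit_mul_eq_zero.mpr (hx j (Finset.mem_singleton_self j))
  have h5 := congrFun (congrArg S h4) i
  rwa [hS, map_zero, Pi.mul_apply, hone, mul_one] at h5

theorem antiAut_local_finset (S : M d ≃ₗ[ℂ] M d) (hS : ∀ x y, S (x * y) = S y * S x)
    (G : Finset I) : ∃ F : Finset I, ∀ x : M d, (∀ j ∈ F, x j = 0) → ∀ i ∈ G, S x i = 0 := by
  classical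
  choose F hF using antiAut_local S hS
  exact ⟨G.biUnion F, fun x hx p hp => hF p x fun i hi => hx i (Finset.mem_biUnion.mpr ⟨p, hp, hi⟩)⟩

theorem comp_antiAut_mem_dual (S : M d ≃ₗ[ℂ] M d) (hS : ∀ x y, S (x * y) = S y * S x)
    {ω : Module.Dual ℂ (M d)} (hω : ω ∈ dual d) : ω.comp S.toLinearMap ∈ dual d := by
  obtain ⟨G, hG⟩ := hω
  obtain ⟨F, hF⟩ := antiAut_local_finset S hS G
  exact ⟨F, fun x hx => hG _ (hF x hx)⟩

theorem antipode_symm_mul (x y : M d) :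
    A.antipode.symm (x * y) = A.antipode.symm y * A.antipode.symm x := by
  rw [LinearEquiv.symm_apply_eq, A.antipode_mul, LinearEquiv.apply_symm_apply,
    LinearEquiv.apply_symm_apply]

theorem antipode_one : A.antipode 1 = 1 := by
  have h := A.antipode_mul (A.antipode.symm 1) 1
  rw [mul_one, LinearEquiv.apply_symm_apply, mul_one] at h
  exact h.symm

end Locality

/-! ### The relations between the legs of an R-matrix -/

section RMatrix

variable {I : Type u} {d : I → ℕ} {A : DiscreteHopfStarAlgebra d} {R : (M₂ d)ˣ}

/-- `(ι ⊗ Δ)(R) = R₁₃ R₁₂` in coordinates. -/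
theorem comul_coeff₂ (hR : IsRMatrix A R) (i : I) (a a' : Fin (d i)) :
    A.comul (coeff₂ R i a a') = ∑ α, tmul (coeff₂ R i α a') (coeff₂ R i a α) := by
  funext p
  obtain ⟨j, k⟩ := p
  ext ⟨b, c⟩ ⟨b', c'⟩
  have h := congrFun (congrFun (congrFun hR.comul_right (i, j, k)) (a, b, c)) (a', b', c')
  refine h.trans ?_
  simp [Matrix.mul_apply, Fintype.sum_prod_type, leg₁₃, leg₁₂, Matrix.sum_apply, tmul, coeff₂,
    mul_comm]

/-- `(Δ ⊗ ι)(R) = R₁₃ R₂₃` in coordinates. -/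
theorem comul_coeff₁ (hR : IsRMatrix A R) (k : I) (c c' : Fin (d k)) :
    A.comul (coeff₁ R k c c') = ∑ γ, tmul (coeff₁ R k c γ) (coeff₁ R k γ c') := by
  funext p
  obtain ⟨i, j⟩ := p
  ext ⟨a, b⟩ ⟨a', b'⟩
  have h := congrFun (congrFun (congrFun hR.comul_left (i, j, k)) (a, b, c)) (a', b', c')
  refine h.trans ?_
  simp [Matrix.mul_apply, Fintype.sum_prod_type, leg₁₃, leg₂₃, Matrix.sum_apply, tmul, coeff₁]

/-- Because `(Δ ⊗ ι)(R) = R₁₃ R₂₃`, the product of the slices of `R` by `ω` and `η` is the slice by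
`(ω ⊗ η)Δ`, which lies in `Â` by nondegeneracy of `Δ`. -/
theorem leftLeg_mul_leftLeg_le (hR : IsRMatrix A R) :
    leftLeg (R : M₂ d) * leftLeg (R : M₂ d) ≤ leftLeg (R : M₂ d) := by
  conv_lhs => rw [leftLeg, Submodule.span_mul_span]
  rw [Submodule.span_le]
  rintro _ ⟨_, ⟨i, a, a', rfl⟩, _, ⟨j, b, b', rfl⟩, rfl⟩
  let ω : Module.Dual ℂ (M d) :=
    { toFun := fun x => A.comul x (i, j) (a, b) (a', b')
      map_add' := fun x y => by simp
      map_smul' := fun c x => by simp }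
  have hω : ω ∈ dual d := by
    obtain ⟨F, hF⟩ := comul_local A (i, j)
    exact ⟨F, fun x hx => congrFun (congrFun (hF x hx) (a, b)) (a', b')⟩
  refine mem_leftLeg_of_eq hω fun k c c' => ?_
  have h := congrFun (congrFun (congrFun (comul_coeff₁ hR k c c') (i, j)) (a, b)) (a', b')
  refine Eq.trans ?_ h.symm
  simp [Matrix.sum_apply, tmul, coeff₁, coeff₂, Matrix.mul_apply]

/-- The slices of `R*` are those of `R₂₁`. -/
theorem star_coeff₁ (hR : IsRMatrix A R) (j : I) (b b' : Fin (d j)) :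
    star (coeff₁ (R : M₂ d) j b b') = coeff₂ R j b' b := by
  funext i
  ext a a'
  exact congrFun (congrFun (congrFun hR.star_eq (i, j)) (a, b')) (a', b)

theorem star_coeff₂ (hR : IsRMatrix A R) (i : I) (a a' : Fin (d i)) :
    star (coeff₂ (R : M₂ d) i a a') = coeff₁ R i a' a := by
  rw [← star_coeff₁ hR, star_star]

theorem star_mem_rightLeg (hR : IsRMatrix A R) {x : M d} (hx : x ∈ leftLeg (R : M₂ d)) :
    star x ∈ rightLeg (R : M₂ d) := by
  induction hx using Submodule.span_induction with
  | mem x h =>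
    obtain ⟨i, a, a', rfl⟩ := h
    rw [star_coeff₂ hR]
    exact coeff₁_mem_rightLeg _ _ _ _
  | zero => simp
  | add x y _ _ h h' => simpa using add_mem h h'
  | smul c x _ h => simpa using (rightLeg (R : M₂ d)).smul_mem (star c) h

theorem star_mem_leftLeg (hR : IsRMatrix A R) {x : M d} (hx : x ∈ rightLeg (R : M₂ d)) :
    star x ∈ leftLeg (R : M₂ d) := by
  induction hx using Submodule.span_induction with
  | mem x h =>
    obtain ⟨i, a, a', rfl⟩ := h
    rw [star_coeff₁ hR]
    exact coeff₂_mem_leftLeg _ _ _ _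
  | zero => simp
  | add x y _ _ h h' => simpa using add_mem h h'
  | smul c x _ h => simpa using (leftLeg (R : M₂ d)).smul_mem (star c) h

theorem rightLeg_mul_rightLeg_le (hR : IsRMatrix A R) :
    rightLeg (R : M₂ d) * rightLeg (R : M₂ d) ≤ rightLeg (R : M₂ d) := by
  refine Submodule.mul_le.mpr fun x hx y hy => ?_
  have h := leftLeg_mul_leftLeg_le hR
    (Submodule.mul_mem_mul (star_mem_leftLeg hR hy) (star_mem_leftLeg hR hx))
  simpa using star_mem_rightLeg hR h

theorem legMatrix₂_mul_inv (i : I) :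
    legMatrix₂ (R : M₂ d) i * legMatrix₂ ((R⁻¹ : (M₂ d)ˣ) : M₂ d) i = 1 := by
  rw [← legMatrix₂_mul, Units.mul_inv, legMatrix₂_one]

theorem legMatrix₂_inv_mul (i : I) :
    legMatrix₂ ((R⁻¹ : (M₂ d)ˣ) : M₂ d) i * legMatrix₂ (R : M₂ d) i = 1 := by
  rw [← legMatrix₂_mul, Units.inv_mul, legMatrix₂_one]

theorem legMatrix₁_mul_inv (i : I) :
    legMatrix₁ (R : M₂ d) i * legMatrix₁ ((R⁻¹ : (M₂ d)ˣ) : M₂ d) i = 1 := by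
  rw [← legMatrix₁_mul, Units.mul_inv, legMatrix₁_one]

/-- `(ι ⊗ ε)(R) = 1`, because `R = R (ι ⊗ ε)(R)` and `R` is invertible. -/
theorem counit_coeff₂ (hR : IsRMatrix A R) (i : I) (a a' : Fin (d i)) :
    A.counit (coeff₂ R i a a') • (1 : M d) = if a = a' then 1 else 0 := by
  let E : Matrix (Fin (d i)) (Fin (d i)) (M d) :=
    Matrix.of fun a a' => A.counit (coeff₂ R i a a') • (1 : M d)
  have h : legMatrix₂ (R : M₂ d) i * E = legMatrix₂ (R : M₂ d) i := by
    ext1 a a'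
    have h1 := A.counit_left (coeff₂ R i a a')
    rw [comul_coeff₂ hR] at h1
    have h2 := (sliceLeft_sum_tmul Finset.univ A.counit.toLinearMap _ _).symm.trans h1
    rw [Matrix.mul_apply]
    refine Eq.trans (Finset.sum_congr rfl fun α _ => ?_) h2
    simp [E, legMatrix₂]
  have hE : E = 1 := by
    rw [← one_mul E, ← legMatrix₂_inv_mul (R := R), mul_assoc, h]
  rw [← Matrix.one_apply, ← hE]
  rfl

/-- `(ε ⊗ ι)(R) = 1`, because `R = (ε ⊗ ι)(R) R` and `R` is invertible. -/
theorem counit_coeff₁ (hR : IsRMatrix A R) (i : I) (a a' : Fin (d i)) :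
    A.counit (coeff₁ R i a a') • (1 : M d) = if a = a' then 1 else 0 := by
  let E : Matrix (Fin (d i)) (Fin (d i)) (M d) :=
    Matrix.of fun a a' => A.counit (coeff₁ R i a a') • (1 : M d)
  have h : E * legMatrix₁ (R : M₂ d) i = legMatrix₁ (R : M₂ d) i := by
    ext1 a a'
    have h1 := A.counit_left (coeff₁ R i a a')
    rw [comul_coeff₁ hR] at h1
    have h2 := (sliceLeft_sum_tmul Finset.univ A.counit.toLinearMap _ _).symm.trans h1
    rw [Matrix.mul_apply]
    refine Eq.trans (Finset.sum_congr rfl fun α _ => ?_) h2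
    simp [E, legMatrix₁]
  have hE : E = 1 := by
    rw [← mul_one E, ← legMatrix₁_mul_inv (R := R), ← mul_assoc, h]
  rw [← Matrix.one_apply, ← hE]
  rfl

theorem one_mem_leftLeg (hR : IsRMatrix A R) : (1 : M d) ∈ leftLeg (R : M₂ d) := by
  refine mem_leftLeg_of_eq (counit_mem_dual A) fun j b b' => ?_
  have h := congrArg A.counit (counit_coeff₁ hR j b b')
  rw [map_smul, map_one, smul_eq_mul, mul_one] at h
  refine Eq.trans ?_ h.symm
  rw [Pi.one_apply, Matrix.one_apply]
  split_ifs <;> simp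

theorem one_mem_rightLeg (hR : IsRMatrix A R) : (1 : M d) ∈ rightLeg (R : M₂ d) := by
  simpa using star_mem_rightLeg hR (one_mem_leftLeg hR)

/-- `(S ⊗ ι)(R) = R⁻¹`. -/
theorem antipode_coeff₁ (hR : IsRMatrix A R) (j : I) (b b' : Fin (d j)) :
    A.antipode (coeff₁ R j b b') = coeff₁ ((R⁻¹ : (M₂ d)ˣ) : M₂ d) j b b' := by
  have h : (legMatrix₁ (R : M₂ d) j).map A.antipode * legMatrix₁ (R : M₂ d) j = 1 := by
    ext1 c c'
    have h1 := A.antipode_left (coeff₁ R j c c')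
    rw [comul_coeff₁ hR, counit_coeff₁ hR] at h1
    rw [Matrix.mul_apply, Matrix.one_apply, ← h1]
    exact (mulMapLeft_sum_tmul Finset.univ A.antipode.toLinearMap _ _).symm
  exact congrArg (fun X => X b b') (left_inv_eq_right_inv h (legMatrix₁_mul_inv j))

theorem sum_antipode_coeff₂_mul (hR : IsRMatrix A R) (i : I) (a a' : Fin (d i)) :
    ∑ α, A.antipode (coeff₂ R i α a') * coeff₂ R i a α = if a = a' then 1 else 0 := by
  have h1 := A.antipode_left (coeff₂ R i a a')
  rw [comul_coeff₂ hR, counit_coeff₂ hR] at h1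
  rw [← h1]
  exact (mulMapLeft_sum_tmul Finset.univ A.antipode.toLinearMap _ _).symm

theorem sum_coeff₂_mul_antipode (hR : IsRMatrix A R) (i : I) (a a' : Fin (d i)) :
    ∑ α, coeff₂ R i α a' * A.antipode (coeff₂ R i a α) = if a = a' then 1 else 0 := by
  have h1 := A.antipode_right (coeff₂ R i a a')
  rw [comul_coeff₂ hR, counit_coeff₂ hR] at h1
  rw [← h1]
  exact (mulMapRight_sum_tmul Finset.univ A.antipode.toLinearMap _ _).symm

/-- `(ι ⊗ S)(R⁻¹) = R`: in matrices over `M(A)` with transposed indices, both sides are inverse to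
`(ι ⊗ S)(R)`. -/
theorem antipode_coeff₂_inv (hR : IsRMatrix A R) (i : I) (a a' : Fin (d i)) :
    A.antipode (coeff₂ ((R⁻¹ : (M₂ d)ˣ) : M₂ d) i a a') = coeff₂ R i a a' := by
  let Q := ((legMatrix₂ (R : M₂ d) i).map A.antipode).transpose
  have h1 : Q * (legMatrix₂ (R : M₂ d) i).transpose = 1 := by
    ext1 c c'
    rw [Matrix.mul_apply, Matrix.one_apply]
    simp only [eq_comm (a := c)]
    exact sum_antipode_coeff₂_mul hR i c' c
  have h2 : ((legMatrix₂ ((R⁻¹ : (M₂ d)ˣ) : M₂ d) i).map A.antipode).transpose * Q = 1 := by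
    ext1 c c'
    have h := congrArg A.antipode (congrFun (congrFun (legMatrix₂_mul_inv (R := R) i) c') c)
    rw [Matrix.mul_apply, map_sum] at h
    simp only [A.antipode_mul] at h
    rw [Matrix.mul_apply]
    refine Eq.trans h ?_
    rw [Matrix.one_apply, Matrix.one_apply]
    by_cases hc : c = c'
    · simp [hc, antipode_one]
    · simp [hc, Ne.symm hc]
  exact congrArg (fun X => X a' a) (left_inv_eq_right_inv h2 h1)

/-- By `(S ⊗ ι)(R) = R⁻¹`, the slice `(ω ⊗ ι)(R⁻¹)` is the slice of `R` by `ω ∘ S`. -/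
theorem leftLeg_inv (hR : IsRMatrix A R) :
    leftLeg ((R⁻¹ : (M₂ d)ˣ) : M₂ d) = leftLeg (R : M₂ d) := by
  refine le_antisymm (Submodule.span_le.mpr ?_) (Submodule.span_le.mpr ?_)
  · rintro _ ⟨i, a, a', rfl⟩
    refine mem_leftLeg_of_eq (comp_antiAut_mem_dual A.antipode A.antipode_mul
      (entry_mem_dual i a a')) fun j b b' => ?_
    exact congrFun (congrFun (congrFun (antipode_coeff₁ hR j b b').symm i) a) a'
  · rintro _ ⟨i, a, a', rfl⟩
    refine mem_leftLeg_of_eq (comp_antiAut_mem_dual A.antipode.symm (antipode_symm_mul A)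
      (entry_mem_dual i a a')) fun j b b' => ?_
    have h := (LinearEquiv.symm_apply_eq _).mpr (antipode_coeff₁ hR j b b').symm
    exact congrFun (congrFun (congrFun h.symm i) a) a'

/-- By `(ι ⊗ S)(R⁻¹) = R`, the slice `(ι ⊗ η)(R)` is the slice of `R⁻¹` by `η ∘ S`. -/
theorem rightLeg_inv (hR : IsRMatrix A R) :
    rightLeg ((R⁻¹ : (M₂ d)ˣ) : M₂ d) = rightLeg (R : M₂ d) := by
  refine le_antisymm (Submodule.span_le.mpr ?_) (Submodule.span_le.mpr ?_)
  · rintro _ ⟨i, a, a', rfl⟩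
    refine mem_rightLeg_of_eq (comp_antiAut_mem_dual A.antipode.symm (antipode_symm_mul A)
      (entry_mem_dual i a a')) fun j b b' => ?_
    have h := (LinearEquiv.symm_apply_eq _).mpr (antipode_coeff₂_inv hR j b b').symm
    exact congrFun (congrFun (congrFun h.symm i) a) a'
  · rintro _ ⟨i, a, a', rfl⟩
    refine mem_rightLeg_of_eq (comp_antiAut_mem_dual A.antipode A.antipode_mul
      (entry_mem_dual i a a')) fun j b b' => ?_
    exact congrFun (congrFun (congrFun (antipode_coeff₂_inv hR j b b').symm i) a) a'

/-- `S` carries the slices `(ω ⊗ ι)(R⁻¹)` to the slices `(ω ⊗ ι)(R)`,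
and both have the same span. -/
theorem map_antipode_leftLeg (hR : IsRMatrix A R) :
    (leftLeg (R : M₂ d)).map A.antipode.toLinearMap = leftLeg (R : M₂ d) := by
  conv_lhs => rw [← leftLeg_inv hR]
  rw [leftLeg, Submodule.map_span, leftLeg]
  congr 1
  ext x
  constructor
  · rintro ⟨_, ⟨i, a, a', rfl⟩, rfl⟩
    exact ⟨i, a, a', antipode_coeff₂_inv hR i a a'⟩
  · rintro ⟨i, a, a', rfl⟩
    exact ⟨_, ⟨i, a, a', rfl⟩, antipode_coeff₂_inv hR i a a'⟩

/-- `S` carries the slices `(ι ⊗ η)(R)` to the slices `(ι ⊗ η)(R⁻¹)`,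
and both have the same span. -/
theorem map_antipode_rightLeg (hR : IsRMatrix A R) :
    (rightLeg (R : M₂ d)).map A.antipode.toLinearMap = rightLeg (R : M₂ d) := by
  conv_rhs => rw [← rightLeg_inv hR]
  rw [rightLeg, Submodule.map_span, rightLeg]
  congr 1
  ext x
  constructor
  · rintro ⟨_, ⟨i, a, a', rfl⟩, rfl⟩
    exact ⟨i, a, a', antipode_coeff₁ hR i a a'⟩
  · rintro ⟨i, a, a', rfl⟩
    exact ⟨_, ⟨i, a, a', rfl⟩, antipode_coeff₁ hR i a a'⟩

theorem coeff₁_flip (X : M₂ d) (j : I) (b b' : Fin (d j)) :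
    coeff₁ (flip X) j b b' = coeff₂ X j b b' := rfl

/-- The exchange relation between the two legs, a slice of the Yang-Baxter equation
`R₂₃ R₁₃ R₁₂ = R₁₂ R₁₃ R₂₃`. -/
theorem exchange (hR : IsRMatrix A R) (i k : I) (a a' : Fin (d i)) (c c' : Fin (d k)) :
    ∑ α, ∑ γ, (R : M₂ d) (i, k) (a, γ) (α, c') • (coeff₁ R k c γ * coeff₂ R i α a') =
      ∑ α, ∑ γ, (R : M₂ d) (i, k) (α, c) (a', γ) • (coeff₂ R i a α * coeff₁ R k γ c') := by
  have h1 : flip (A.comul (coeff₂ R i a a')) * (R : M₂ d) =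
      (R : M₂ d) * A.comul (coeff₂ R i a a') := by
    rw [hR.comul_op, mul_assoc, mul_assoc, Units.inv_mul, mul_one]
  have h2 := congrArg (fun X => coeff₁ X k c c') h1
  simp only [coeff₁_mul, coeff₁_flip, comul_coeff₂ hR, coeff₁_sum, coeff₂_sum, coeff₁_tmul,
    coeff₂_tmul, Finset.mul_sum, Finset.sum_mul, mul_smul_comm, smul_mul_assoc] at h2
  rw [Finset.sum_comm (γ := Fin (d k))] at h2
  exact h2.symm

/-- Inversion of linear relations: `V` contains the vectors `X` once it contains their combinations
with a coefficient matrix `ρ` that has a left inverse `T`. -/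
theorem mem_of_sum_smul_mem {E ι κ ι' κ' : Type*} [AddCommGroup E] [Module ℂ E] [Fintype ι]
    [Fintype κ] [Fintype ι'] [Fintype κ'] [DecidableEq ι'] [DecidableEq κ'] (V : Submodule ℂ E)
    (T : ι → κ → ℂ) (ρ : ι → κ → ι' → κ' → ℂ) (X : ι' → κ' → E) (α₀ : ι') (γ₀ : κ')
    (h : ∀ α γ, ∑ a, ∑ c, T a c * ρ a c α γ = if α = α₀ then if γ = γ₀ then 1 else 0 else 0)
    (hX : ∀ a c, ∑ α, ∑ γ, ρ a c α γ • X α γ ∈ V) : X α₀ γ₀ ∈ V := by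
  have h1 : ∑ a, ∑ c, T a c • ∑ α, ∑ γ, ρ a c α γ • X α γ = X α₀ γ₀ := by
    calc _ = ∑ a, ∑ c, ∑ α, ∑ γ, (T a c * ρ a c α γ) • X α γ := by
          simp only [Finset.smul_sum, mul_smul]
      _ = ∑ a, ∑ α, ∑ c, ∑ γ, (T a c * ρ a c α γ) • X α γ :=
          Finset.sum_congr rfl fun _ _ => Finset.sum_comm
      _ = ∑ α, ∑ a, ∑ c, ∑ γ, (T a c * ρ a c α γ) • X α γ := Finset.sum_comm
      _ = ∑ α, ∑ a, ∑ γ, ∑ c, (T a c * ρ a c α γ) • X α γ :=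
          Finset.sum_congr rfl fun _ _ => Finset.sum_congr rfl fun _ _ => Finset.sum_comm
      _ = ∑ α, ∑ γ, ∑ a, ∑ c, (T a c * ρ a c α γ) • X α γ :=
          Finset.sum_congr rfl fun _ _ => Finset.sum_comm
      _ = ∑ α, ∑ γ, (∑ a, ∑ c, T a c * ρ a c α γ) • X α γ := by simp only [Finset.sum_smul]
      _ = X α₀ γ₀ := by simp [h]
  rw [← h1]
  exact V.sum_mem fun a _ => V.sum_mem fun c _ => V.smul_mem _ (hX a c)

/-- In the exchange relation the partial transpose of `R` on the left-hand side is inverted by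
`(ι ⊗ S)(R)`. -/
theorem rightLeg_mul_leftLeg_le (hR : IsRMatrix A R) :
    rightLeg (R : M₂ d) * leftLeg (R : M₂ d) ≤ leftLeg (R : M₂ d) * rightLeg (R : M₂ d) := by
  conv_lhs => rw [leftLeg, rightLeg, Submodule.span_mul_span]
  rw [Submodule.span_le]
  rintro _ ⟨_, ⟨k, c, γ₀, rfl⟩, _, ⟨i, α₀, a', rfl⟩, rfl⟩
  refine mem_of_sum_smul_mem _ (fun a c' => A.antipode (coeff₂ R i α₀ a) k c' γ₀)
    (fun a c' α γ => (R : M₂ d) (i, k) (a, γ) (α, c'))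
    (fun α γ => coeff₁ R k c γ * coeff₂ R i α a') α₀ γ₀ (fun α γ => ?_) fun a c' => ?_
  · have h := congrFun (congrFun (congrFun (sum_coeff₂_mul_antipode hR i α₀ α) k) γ) γ₀
    simp only [Finset.sum_apply, Matrix.sum_apply, Pi.mul_apply, Matrix.mul_apply] at h
    simp only [mul_comm (A.antipode _ k _ _)]
    refine h.trans ?_
    by_cases h1 : α = α₀
    · simp [h1, Matrix.one_apply]
    · simp [h1, Ne.symm h1]
  · rw [exchange hR]
    exact Submodule.sum_mem _ fun α _ => Submodule.sum_mem _ fun γ _ => Submodule.smul_mem _ _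
      (Submodule.mul_mem_mul (coeff₂_mem_leftLeg _ _ _ _) (coeff₁_mem_rightLeg _ _ _ _))

/-- On the right-hand side of the exchange relation it is the other partial transpose of `R`, and
`(ι ⊗ S)(R)` inverts it as well. -/
theorem leftLeg_mul_rightLeg_le (hR : IsRMatrix A R) :
    leftLeg (R : M₂ d) * rightLeg (R : M₂ d) ≤ rightLeg (R : M₂ d) * leftLeg (R : M₂ d) := by
  conv_lhs => rw [leftLeg, rightLeg, Submodule.span_mul_span]
  rw [Submodule.span_le]
  rintro _ ⟨_, ⟨i, a, α₀, rfl⟩, _, ⟨k, γ₀, c', rfl⟩, rfl⟩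
  refine mem_of_sum_smul_mem _ (fun a' c => A.antipode (coeff₂ R i a' α₀) k γ₀ c)
    (fun a' c α γ => (R : M₂ d) (i, k) (α, c) (a', γ))
    (fun α γ => coeff₂ R i a α * coeff₁ R k γ c') α₀ γ₀ (fun α γ => ?_) fun a' c => ?_
  · have h := congrFun (congrFun (congrFun (sum_antipode_coeff₂_mul hR i α α₀) k) γ₀) γ
    simp only [Finset.sum_apply, Matrix.sum_apply, Pi.mul_apply, Matrix.mul_apply] at h
    refine h.trans ?_
    by_cases h1 : α = α₀
    · simp [h1, Matrix.one_apply, eq_comm]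
    · simp [h1]
  · rw [← exchange hR]
    exact Submodule.sum_mem _ fun α _ => Submodule.sum_mem _ fun γ _ => Submodule.smul_mem _ _
      (Submodule.mul_mem_mul (coeff₁_mem_rightLeg _ _ _ _) (coeff₂_mem_leftLeg _ _ _ _))

theorem map_mul_of_antiMul {E : Type*} [Ring E] [Algebra ℂ E] (S : E ≃ₗ[ℂ] E)
    (hS : ∀ x y, S (x * y) = S y * S x) (V W : Submodule ℂ E) :
    (V * W).map S.toLinearMap = W.map S.toLinearMap * V.map S.toLinearMap := by
  refine le_antisymm (Submodule.map_le_iff_le_comap.mpr (Submodule.mul_le.mpr fun x hx y hy => ?_))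
    (Submodule.mul_le.mpr ?_)
  · rw [Submodule.mem_comap, LinearEquiv.coe_coe, hS]
    exact Submodule.mul_mem_mul ⟨y, hy, rfl⟩ ⟨x, hx, rfl⟩
  · rintro _ ⟨y, hy, rfl⟩ _ ⟨x, hx, rfl⟩
    exact ⟨x * y, Submodule.mul_mem_mul hx hy, hS x y⟩

theorem comul_mem_of_mem_leftLeg (hR : IsRMatrix A R) {x : M d} (hx : x ∈ leftLeg (R : M₂ d)) :
    A.comul x ∈ tensor (leftLeg (R : M₂ d)) (leftLeg (R : M₂ d)) := by
  induction hx using Submodule.span_induction with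
  | mem x h =>
    obtain ⟨i, a, a', rfl⟩ := h
    rw [comul_coeff₂ hR]
    exact Submodule.sum_mem _ fun α _ =>
      tmul_mem_tensor (coeff₂_mem_leftLeg _ _ _ _) (coeff₂_mem_leftLeg _ _ _ _)
  | zero => simp
  | add x y _ _ h h' => simpa using add_mem h h'
  | smul c x _ h => simpa using Submodule.smul_mem _ c h

theorem comul_mem_of_mem_rightLeg (hR : IsRMatrix A R) {x : M d} (hx : x ∈ rightLeg (R : M₂ d)) :
    A.comul x ∈ tensor (rightLeg (R : M₂ d)) (rightLeg (R : M₂ d)) := by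
  induction hx using Submodule.span_induction with
  | mem x h =>
    obtain ⟨i, a, a', rfl⟩ := h
    rw [comul_coeff₁ hR]
    exact Submodule.sum_mem _ fun α _ =>
      tmul_mem_tensor (coeff₁_mem_rightLeg _ _ _ _) (coeff₁_mem_rightLeg _ _ _ _)
  | zero => simp
  | add x y _ _ h h' => simpa using add_mem h h'
  | smul c x _ h => simpa using Submodule.smul_mem _ c h

theorem leftLeg_le_sliceSpan (hR : IsRMatrix A R) :
    leftLeg (R : M₂ d) ≤ sliceSpan (R : M₂ d) := fun x hx => by
  rw [sliceSpan_eq, ← mul_one x]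
  exact Submodule.mul_mem_mul hx (one_mem_rightLeg hR)

theorem rightLeg_le_sliceSpan (hR : IsRMatrix A R) :
    rightLeg (R : M₂ d) ≤ sliceSpan (R : M₂ d) := fun x hx => by
  rw [sliceSpan_eq, ← one_mul x]
  exact Submodule.mul_mem_mul (one_mem_leftLeg hR) hx

theorem isHopfStarSubalgebra_sliceSpan (hR : IsRMatrix A R) :
    IsHopfStarSubalgebra A (sliceSpan (R : M₂ d)) where
  one_mem := leftLeg_le_sliceSpan hR (one_mem_leftLeg hR)
  mul_mem x hx y hy := by
    rw [sliceSpan_eq] at *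
    have h : leftLeg (R : M₂ d) * rightLeg (R : M₂ d) * (leftLeg (R : M₂ d) * rightLeg (R : M₂ d))
        ≤ leftLeg (R : M₂ d) * rightLeg (R : M₂ d) :=
      calc leftLeg (R : M₂ d) * rightLeg (R : M₂ d) * (leftLeg (R : M₂ d) * rightLeg (R : M₂ d))
          = leftLeg (R : M₂ d) * (rightLeg (R : M₂ d) * leftLeg (R : M₂ d)) *
              rightLeg (R : M₂ d) := by simp only [mul_assoc]
        _ ≤ leftLeg (R : M₂ d) * (leftLeg (R : M₂ d) * rightLeg (R : M₂ d)) *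
              rightLeg (R : M₂ d) :=
            mul_le_mul' (mul_le_mul' le_rfl (rightLeg_mul_leftLeg_le hR)) le_rfl
        _ = (leftLeg (R : M₂ d) * leftLeg (R : M₂ d)) *
              (rightLeg (R : M₂ d) * rightLeg (R : M₂ d)) := by simp only [mul_assoc]
        _ ≤ leftLeg (R : M₂ d) * rightLeg (R : M₂ d) :=
            mul_le_mul' (leftLeg_mul_leftLeg_le hR) (rightLeg_mul_rightLeg_le hR)
    exact h (Submodule.mul_mem_mul hx hy)
  star_mem x hx := by
    rw [sliceSpan_eq] at *
    induction hx using Submodule.mul_induction_on' with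
    | mem_mul_mem x hx y hy =>
      rw [star_mul]
      exact Submodule.mul_mem_mul (star_mem_leftLeg hR hy) (star_mem_rightLeg hR hx)
    | add x _ y _ h h' =>
      rw [star_add]
      exact add_mem h h'
  comul_mem x hx := by
    rw [sliceSpan_eq] at *
    induction hx using Submodule.mul_induction_on' with
    | mem_mul_mem x hx y hy =>
      rw [map_mul]
      exact tensor_mul_tensor_le _ _ _ _ (Submodule.mul_mem_mul (comul_mem_of_mem_leftLeg hR hx)
        (comul_mem_of_mem_rightLeg hR hy))
    | add x _ y _ h h' =>
      rw [map_add]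
      exact add_mem h h'
  antipode_image := by
    have h := map_mul_of_antiMul A.antipode A.antipode_mul (leftLeg (R : M₂ d))
      (rightLeg (R : M₂ d))
    rw [map_antipode_leftLeg hR, map_antipode_rightLeg hR,
      le_antisymm (rightLeg_mul_leftLeg_le hR) (leftLeg_mul_rightLeg_le hR), ← sliceSpan_eq] at h
    exact congrArg (fun V : Submodule ℂ (M d) => (V : Set (M d))) h

end RMatrix

/-! ### The blockwise closure of a Hopf `*`-subalgebra -/

section BlockClosure

variable {J : Type u} {n : J → Type} [∀ j, Fintype (n j)] [∀ j, DecidableEq (n j)]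

/-- The elements that agree on each finite set of blocks with an element of `U`. -/
def blockClosure (U : StarSubalgebra ℂ (Blocks n)) : StarSubalgebra ℂ (Blocks n) where
  carrier := {x | ∀ F : Finset J, ∃ u ∈ U, ∀ j ∈ F, u j = x j}
  mul_mem' {x y} hx hy F := by
    obtain ⟨u, hu, hux⟩ := hx F
    obtain ⟨v, hv, hvy⟩ := hy F
    exact ⟨u * v, mul_mem hu hv, fun j hj => by simp [hux j hj, hvy j hj]⟩
  add_mem' {x y} hx hy F := by
    obtain ⟨u, hu, hux⟩ := hx F
    obtain ⟨v, hv, hvy⟩ := hy F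
    exact ⟨u + v, add_mem hu hv, fun j hj => by simp [hux j hj, hvy j hj]⟩
  algebraMap_mem' c F := ⟨_, U.algebraMap_mem c, fun _ _ => rfl⟩
  star_mem' {x} hx F := by
    obtain ⟨u, hu, hux⟩ := hx F
    exact ⟨star u, star_mem hu, fun j hj => by simp [hux j hj]⟩

theorem le_blockClosure (U : StarSubalgebra ℂ (Blocks n)) : U ≤ blockClosure U :=
  fun x hx _ => ⟨x, hx, fun _ _ => rfl⟩

theorem isBlockClosed_blockClosure (U : StarSubalgebra ℂ (Blocks n)) :
    IsBlockClosed (blockClosure U) := fun x hx F => by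
  obtain ⟨v, hv, hvx⟩ := hx F
  obtain ⟨u, hu, huv⟩ := hv F
  exact ⟨u, hu, fun j hj => (huv j hj).trans (hvx j hj)⟩

theorem mem_multipliers_finitePart_iff {N : StarSubalgebra ℂ (Blocks n)} (hN : IsBlockClosed N)
    {x : Blocks n} : x ∈ multipliers (finitePart N).toSubmodule ↔ x ∈ N := by
  refine ⟨fun hx => hN x fun F => ?_, fun hx b hb =>
    ⟨mul_mem_finitePart hx hb, finitePart_mul_mem hx hb⟩⟩
  obtain ⟨p, -, hpB, hpF, -⟩ := exists_central_local_unit hN F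
  exact ⟨x * p, finitePart_le (hx p hpB).1, fun j hj => by simp [hpF j hj]⟩

end BlockClosure

section Tensor

variable {I : Type u} {d : I → ℕ}

theorem mul_tmul_mem_tensor {V W : Submodule ℂ (M d)} {X : M₂ d} (hX : X ∈ tensor V W)
    (b c : M d) : X * tmul b c ∈
      tensor (V.map (LinearMap.mulRight ℂ b)) (W.map (LinearMap.mulRight ℂ c)) := by
  induction hX using Submodule.span_induction with
  | mem X h =>
    obtain ⟨x, hx, y, hy, rfl⟩ := h
    rw [tmul_mul_tmul]
    exact tmul_mem_tensor ⟨x, hx, rfl⟩ ⟨y, hy, rfl⟩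
  | zero => rw [zero_mul]; exact Submodule.zero_mem _
  | add X Y _ _ h h' => rw [add_mul]; exact add_mem h h'
  | smul r X _ h => rw [smul_mul_assoc]; exact Submodule.smul_mem _ r h

theorem tmul_mul_mem_tensor {V W : Submodule ℂ (M d)} {X : M₂ d} (hX : X ∈ tensor V W)
    (b c : M d) : tmul b c * X ∈
      tensor (V.map (LinearMap.mulLeft ℂ b)) (W.map (LinearMap.mulLeft ℂ c)) := by
  induction hX using Submodule.span_induction with
  | mem X h =>
    obtain ⟨x, hx, y, hy, rfl⟩ := h
    rw [tmul_mul_tmul]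
    exact tmul_mem_tensor ⟨x, hx, rfl⟩ ⟨y, hy, rfl⟩
  | zero => rw [mul_zero]; exact Submodule.zero_mem _
  | add X Y _ _ h h' => rw [mul_add]; exact add_mem h h'
  | smul r X _ h => rw [mul_smul_comm]; exact Submodule.smul_mem _ r h

theorem mem_multipliers_tensor {V : Submodule ℂ (M d)} {X : M₂ d}
    (h : ∀ b ∈ V, ∀ c ∈ V, X * tmul b c ∈ tensor V V ∧ tmul b c * X ∈ tensor V V) :
    X ∈ multipliers (tensor V V) := by
  intro t ht
  induction ht using Submodule.span_induction with
  | mem t h' =>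
    obtain ⟨b, hb, c, hc, rfl⟩ := h'
    exact h b hb c hc
  | zero => simp
  | add t s _ _ h h' =>
    rw [mul_add, add_mul]
    exact ⟨add_mem h.1 h'.1, add_mem h.2 h'.2⟩
  | smul r t _ h =>
    rw [mul_smul_comm, smul_mul_assoc]
    exact ⟨Submodule.smul_mem _ r h.1, Submodule.smul_mem _ r h.2⟩

/-- If the slices `(ω ⊗ ι)(X)` lie in a finite-dimensional space `V` and the slices `(ι ⊗ η)(X)`
lie in `W`, then `X ∈ W ⊗ V`: expand the second leg in a basis of `V`, whose coordinate
functionals extend to elements of `Â`. -/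
theorem mem_tensor_of_coeff_mem {V W : Submodule ℂ (M d)} [FiniteDimensional ℂ V] {X : M₂ d}
    (hV : ∀ i a a', coeff₂ X i a a' ∈ V) (hW : ∀ j b b', coeff₁ X j b b' ∈ W) :
    X ∈ tensor W V := by
  obtain ⟨F, hF⟩ := exists_finset_separating V
  let ρ : M d →ₗ[ℂ] (∀ j : F, Matrix (Fin (d j)) (Fin (d j)) ℂ) :=
    { toFun := fun x j => x j
      map_add' := fun _ _ => rfl
      map_smul' := fun _ _ => rfl }
  obtain ⟨g, hg⟩ := (ρ.comp V.subtype).exists_leftInverse_of_injective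
    (LinearMap.ker_eq_bot'.mpr fun v hv =>
      Subtype.ext (hF v v.2 fun j hj => congrFun hv ⟨j, hj⟩))
  let B := Module.finBasis ℂ V
  let η : Fin (Module.finrank ℂ V) → Module.Dual ℂ (M d) := fun k => (B.coord k).comp (g.comp ρ)
  have hη : ∀ k, η k ∈ dual d := fun k => ⟨F, fun x hx => by
    have h0 : ρ x = 0 := funext fun j => hx j j.2
    simp [η, h0]⟩
  have hexp : ∀ v ∈ V, v = ∑ k, η k v • (B k : M d) := by
    intro v hv
    have h1 := congrArg Subtype.val (B.sum_repr ⟨v, hv⟩)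
    have h2 : g (ρ v) = ⟨v, hv⟩ := LinearMap.congr_fun hg ⟨v, hv⟩
    simp only [Submodule.coe_sum, Submodule.coe_smul] at h1
    conv_lhs => rw [← h1]
    refine Finset.sum_congr rfl fun k _ => ?_
    simp [η, h2]
  have hsum : X = ∑ k, tmul (sliceRight (η k) X) (B k : M d) := by
    funext p
    obtain ⟨i, j⟩ := p
    ext ⟨a, b⟩ ⟨a', b'⟩
    have h := congrFun (congrFun (congrFun (hexp _ (hV i a a')) j) b) b'
    refine h.trans ?_
    simp [Matrix.sum_apply, tmul, sliceRight]
  have hle : rightLeg X ≤ W := Submodule.span_le.mpr (by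
    rintro _ ⟨j, b, b', rfl⟩
    exact hW j b b')
  rw [hsum]
  exact Submodule.sum_mem _ fun k _ =>
    tmul_mem_tensor (hle (sliceRight_mem_rightLeg (hη k) X)) (B k).2

end Tensor

section HopfSubalgebra

variable {I : Type u} {d : I → ℕ} {A : DiscreteHopfStarAlgebra d} {U : Submodule ℂ (M d)}

/-- A unital Hopf `*`-subalgebra, as a `*`-subalgebra. -/
def IsHopfStarSubalgebra.toStarSubalgebra (hU : IsHopfStarSubalgebra A U) :
    StarSubalgebra ℂ (M d) where
  carrier := U
  mul_mem' hx hy := hU.mul_mem _ hx _ hy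
  add_mem' hx hy := U.add_mem hx hy
  algebraMap_mem' c := by
    rw [Algebra.algebraMap_eq_smul_one]
    exact U.smul_mem c hU.one_mem
  star_mem' hx := hU.star_mem _ hx

/-- The `σ(M(A), Â)`-closure of a Hopf `*`-subalgebra. -/
def IsHopfStarSubalgebra.closure (hU : IsHopfStarSubalgebra A U) : StarSubalgebra ℂ (M d) :=
  blockClosure hU.toStarSubalgebra

theorem IsHopfStarSubalgebra.isBlockClosed (hU : IsHopfStarSubalgebra A U) :
    IsBlockClosed hU.closure := isBlockClosed_blockClosure _

theorem IsHopfStarSubalgebra.mem_closure (hU : IsHopfStarSubalgebra A U) {x : M d} (hx : x ∈ U) :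
    x ∈ hU.closure := le_blockClosure hU.toStarSubalgebra hx

theorem IsHopfStarSubalgebra.le_closure (hU : IsHopfStarSubalgebra A U) :
    U ≤ hU.closure.toSubalgebra.toSubmodule := fun _ hx => hU.mem_closure hx

theorem antiAut_mem_closure (hU : IsHopfStarSubalgebra A U) (S : M d ≃ₗ[ℂ] M d)
    (hS : ∀ x y, S (x * y) = S y * S x) (hSU : ∀ x ∈ U, S x ∈ U) {x : M d} (hx : x ∈ hU.closure) :
    S x ∈ hU.closure := by
  intro G
  obtain ⟨F, hF⟩ := antiAut_local_finset S hS G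
  obtain ⟨u, hu, hux⟩ := hx F
  refine ⟨S u, hSU u hu, fun i hi => ?_⟩
  have := hF (u - x) (fun j hj => by simp [hux j hj]) i hi
  rwa [map_sub, Pi.sub_apply, sub_eq_zero] at this

theorem antiAut_mem_finitePart (hU : IsHopfStarSubalgebra A U) (S : M d ≃ₗ[ℂ] M d)
    (hS : ∀ x y, S (x * y) = S y * S x) (hS' : ∀ x y, S.symm (x * y) = S.symm y * S.symm x)
    (hSU : ∀ x ∈ U, S x ∈ U) (hSU' : ∀ x ∈ U, S.symm x ∈ U) {b : M d}
    (hb : b ∈ finitePart hU.closure) : S b ∈ finitePart hU.closure := by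
  obtain ⟨hb, F, hF⟩ := hb
  obtain ⟨G, hG⟩ := antiAut_local_finset S.symm hS' F
  refine ⟨antiAut_mem_closure hU S hS hSU hb, G, fun y hy => ?_⟩
  have h := hF (S.symm y) ⟨antiAut_mem_closure hU S.symm hS' hSU' hy.1, hG y hy.2⟩
  constructor
  · simpa [hS] using congrArg S h.2
  · simpa [hS] using congrArg S h.1

theorem antipode_image_finitePart (hU : IsHopfStarSubalgebra A U) :
    A.antipode '' (finitePart hU.closure : Set (M d)) = finitePart hU.closure := by
  have h1 : ∀ x ∈ U, A.antipode x ∈ U := fun x hx => by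
    have : A.antipode x ∈ A.antipode '' (U : Set (M d)) := ⟨x, hx, rfl⟩
    rwa [hU.antipode_image] at this
  have h2 : ∀ x ∈ U, A.antipode.symm x ∈ U := fun x hx => by
    have hx' : x ∈ (U : Set (M d)) := hx
    rw [← hU.antipode_image] at hx'
    obtain ⟨y, hy, rfl⟩ := hx'
    rwa [LinearEquiv.symm_apply_apply]
  refine Set.Subset.antisymm ?_ fun b hb => ⟨A.antipode.symm b, ?_, A.antipode.apply_symm_apply b⟩
  · rintro _ ⟨b, hb, rfl⟩
    exact antiAut_mem_finitePart hU A.antipode A.antipode_mul (antipode_symm_mul A) h1 h2 hb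
  · exact antiAut_mem_finitePart hU A.antipode.symm (antipode_symm_mul A) A.antipode_mul h2 h1 hb

theorem leftIdeal_le_finitePart {N : StarSubalgebra ℂ (M d)} {b : M d} (hb : b ∈ finitePart N) :
    leftIdeal N b ≤ (finitePart N).toSubmodule := by
  rintro _ ⟨x, hx, rfl⟩
  exact mul_mem_finitePart hx hb

theorem rightIdeal_le_finitePart {N : StarSubalgebra ℂ (M d)} {b : M d} (hb : b ∈ finitePart N) :
    rightIdeal N b ≤ (finitePart N).toSubmodule := by
  rintro _ ⟨x, hx, rfl⟩
  exact finitePart_mul_mem hx hb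

theorem exists_comul_agree (hU : IsHopfStarSubalgebra A U) {x : M d} (hx : x ∈ hU.closure)
    (G : Finset (I × I)) : ∃ u ∈ U, ∀ p ∈ G, A.comul u p = A.comul x p := by
  obtain ⟨F, hF⟩ := comul_local_finset A G
  obtain ⟨u, hu, hux⟩ := hx F
  refine ⟨u, hu, fun p hp => ?_⟩
  have := hF (u - x) (fun j hj => by simp [hux j hj]) p hp
  rwa [map_sub, Pi.sub_apply, sub_eq_zero] at this

theorem comul_mul_tmul_mem (hU : IsHopfStarSubalgebra A U) {x b c : M d} (hx : x ∈ hU.closure)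
    (hb : b ∈ finitePart hU.closure) (hc : c ∈ finitePart hU.closure) :
    A.comul x * tmul b c ∈ tensor (leftIdeal hU.closure b) (leftIdeal hU.closure c) := by
  have := finiteDimensional_leftIdeal hU.isBlockClosed hb
  have := finiteDimensional_leftIdeal hU.isBlockClosed hc
  have := finiteDimensional_tensor (leftIdeal hU.closure b) (leftIdeal hU.closure c)
  refine mem_of_forall_agree _ _ fun G => ?_
  obtain ⟨u, hu, hux⟩ := exists_comul_agree hU hx G
  exact ⟨A.comul u * tmul b c,
    mul_tmul_mem_tensor (tensor_mono hU.le_closure hU.le_closure (hU.comul_mem u hu)) b c,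
    fun p hp => by rw [Pi.mul_apply, Pi.mul_apply, hux p hp]⟩

theorem tmul_mul_comul_mem (hU : IsHopfStarSubalgebra A U) {x b c : M d} (hx : x ∈ hU.closure)
    (hb : b ∈ finitePart hU.closure) (hc : c ∈ finitePart hU.closure) :
    tmul b c * A.comul x ∈ tensor (rightIdeal hU.closure b) (rightIdeal hU.closure c) := by
  have := finiteDimensional_rightIdeal hU.isBlockClosed hb
  have := finiteDimensional_rightIdeal hU.isBlockClosed hc
  have := finiteDimensional_tensor (rightIdeal hU.closure b) (rightIdeal hU.closure c)
  refine mem_of_forall_agree _ _ fun G => ?_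
  obtain ⟨u, hu, hux⟩ := exists_comul_agree hU hx G
  exact ⟨tmul b c * A.comul u,
    tmul_mul_mem_tensor (tensor_mono hU.le_closure hU.le_closure (hU.comul_mem u hu)) b c,
    fun p hp => by rw [Pi.mul_apply, Pi.mul_apply, hux p hp]⟩

theorem comul_mem_multipliers (hU : IsHopfStarSubalgebra A U) {x : M d} (hx : x ∈ hU.closure) :
    A.comul x ∈ multipliers
      (tensor (finitePart hU.closure).toSubmodule (finitePart hU.closure).toSubmodule) :=
  mem_multipliers_tensor fun _ hb _ hc =>
    ⟨tensor_mono (leftIdeal_le_finitePart hb) (leftIdeal_le_finitePart hc)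
        (comul_mul_tmul_mem hU hx hb hc),
      tensor_mono (rightIdeal_le_finitePart hb) (rightIdeal_le_finitePart hc)
        (tmul_mul_comul_mem hU hx hb hc)⟩

/-- `Δ(p)(b ⊗ c) = b ⊗ c` for a suitable local unit `p`, because only finitely many blocks
of `Δ(p)` matter. -/
theorem exists_comul_mul_tmul_eq (hU : IsHopfStarSubalgebra A U) {b c : M d}
    (hb : b ∈ finitePart hU.closure) (hc : c ∈ finitePart hU.closure) :
    ∃ p ∈ finitePart hU.closure, A.comul p * tmul b c = tmul b c := by
  have := finiteDimensional_leftIdeal hU.isBlockClosed hb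
  have := finiteDimensional_leftIdeal hU.isBlockClosed hc
  have := finiteDimensional_tensor (leftIdeal hU.closure b) (leftIdeal hU.closure c)
  obtain ⟨G, hG⟩ := exists_finset_separating
    (tensor (leftIdeal hU.closure b) (leftIdeal hU.closure c))
  obtain ⟨F, hF⟩ := comul_local_finset A G
  obtain ⟨p, hp, hpB, hpF, -⟩ := exists_central_local_unit hU.isBlockClosed F
  refine ⟨p, hpB, sub_eq_zero.mp ?_⟩
  have h : A.comul p * tmul b c - tmul b c = A.comul (p - 1) * tmul b c := by
    rw [map_sub, map_one, sub_mul, one_mul]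
  rw [h]
  refine hG _ (comul_mul_tmul_mem hU (sub_mem hp.mem (one_mem _)) hb hc) fun q hq => ?_
  rw [Pi.mul_apply, hF (p - 1) (fun j hj => by simp [hpF j hj]) q hq, zero_mul]

theorem isDiscreteHopfStarSubalgebra_finitePart (hU : IsHopfStarSubalgebra A U) :
    IsDiscreteHopfStarSubalgebra A (finitePart hU.closure) where
  directSum := exists_starAlgEquiv_finSupp hU.isBlockClosed
  comul_mem b hb := comul_mem_multipliers hU hb.1
  comul_nondegenerate := by
    refine le_antisymm (Submodule.span_le.mpr ?_) (Submodule.span_le.mpr ?_)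
    · rintro _ ⟨b, hb, t, ht, rfl⟩
      exact (comul_mem_multipliers hU hb.1 t ht).1
    · rintro _ ⟨b, hb, c, hc, rfl⟩
      obtain ⟨p, hp, h⟩ := exists_comul_mul_tmul_eq hU hb hc
      exact Submodule.subset_span ⟨p, hp, tmul b c, tmul_mem_tensor hb hc, h.symm⟩
  counit_nondegenerate := by
    obtain ⟨F, hF⟩ := counit_mem_dual A
    obtain ⟨p, hp, hpB, hpF, -⟩ := exists_central_local_unit hU.isBlockClosed F
    refine ⟨p, hpB, ?_⟩
    have h : A.counit (p - 1) = 0 := hF (p - 1) fun j hj => by simp [hpF j hj]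
    rw [map_sub, map_one, sub_eq_zero] at h
    rw [h]
    exact one_ne_zero
  antipode_image := antipode_image_finitePart hU

theorem sitsNondegenerately_finitePart {N : StarSubalgebra ℂ (M d)} (hN : IsBlockClosed N) :
    SitsNondegenerately (finitePart N) := by
  refine le_antisymm (Submodule.span_le.mpr ?_) fun a ha => ?_
  · rintro _ ⟨b, -, a, ha, rfl⟩
    exact ha.subset fun j hj h0 => hj (by simp [h0])
  · have ha : {j | a j ≠ 0}.Finite := ha
    obtain ⟨p, -, hpB, hpF, -⟩ := exists_central_local_unit hN ha.toFinset
    refine Submodule.subset_span ⟨p, hpB, a, ha, funext fun j => ?_⟩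
    by_cases hj : a j = 0
    · simp [hj]
    · rw [Pi.mul_apply, hpF j (ha.mem_toFinset.mpr hj), one_mul]

/-- An element of `M(A ⊗ A)` whose slices lie in `N` is a multiplier of `B ⊗ B`, for `B` the finite
part of `N`. -/
theorem mem_multipliers_of_coeff_mem {N : StarSubalgebra ℂ (M d)} (hN : IsBlockClosed N) {X : M₂ d}
    (h₂ : ∀ i a a', coeff₂ X i a a' ∈ N) (h₁ : ∀ j b b', coeff₁ X j b b' ∈ N) :
    X ∈ multipliers (tensor (finitePart N).toSubmodule (finitePart N).toSubmodule) := by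
  refine mem_multipliers_tensor fun b hb c hc => ⟨?_, ?_⟩
  · have := finiteDimensional_leftIdeal hN hc
    refine tensor_mono (leftIdeal_le_finitePart hb) (leftIdeal_le_finitePart hc)
      (mem_tensor_of_coeff_mem (fun i a a' => ?_) fun i a a' => ?_)
    · rw [coeff₂_mul]
      refine Submodule.sum_mem _ fun α _ => ?_
      rw [coeff₂_tmul, mul_smul_comm]
      exact Submodule.smul_mem _ _ (mul_mem_leftIdeal (h₂ i a α))
    · rw [coeff₁_mul]
      refine Submodule.sum_mem _ fun α _ => ?_
      rw [coeff₁_tmul, mul_smul_comm]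
      exact Submodule.smul_mem _ _ (mul_mem_leftIdeal (h₁ i a α))
  · have := finiteDimensional_rightIdeal hN hc
    refine tensor_mono (rightIdeal_le_finitePart hb) (rightIdeal_le_finitePart hc)
      (mem_tensor_of_coeff_mem (fun i a a' => ?_) fun i a a' => ?_)
    · rw [coeff₂_mul]
      refine Submodule.sum_mem _ fun α _ => ?_
      rw [coeff₂_tmul, smul_mul_assoc]
      exact Submodule.smul_mem _ _ ⟨_, h₂ i α a', rfl⟩
    · rw [coeff₁_mul]
      refine Submodule.sum_mem _ fun α _ => ?_
      rw [coeff₁_tmul, smul_mul_assoc]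
      exact Submodule.smul_mem _ _ ⟨_, h₁ i α a', rfl⟩

/-- Elements that are blockwise approximated by `V` lie in the `σ(M(A), Â)`-closure of `V`. -/
theorem mem_closure_sigmaTopology {V : Set (M d)} {x : M d}
    (hx : ∀ F : Finset I, ∃ v ∈ V, ∀ j ∈ F, v j = x j) :
    x ∈ @closure (M d) (sigmaTopology d) V := by
  classical
  choose v hvV hv using hx
  have ht : Filter.Tendsto v Filter.atTop (@nhds (M d) (sigmaTopology d) x) := by
    rw [nhds_iInf, Filter.tendsto_iInf]
    intro ω
    rw [nhds_induced, Filter.tendsto_comap_iff]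
    obtain ⟨F, hF⟩ := ω.2
    refine tendsto_const_nhds.congr' ?_
    filter_upwards [Filter.eventually_ge_atTop F] with G hG
    have := hF (x - v G) fun j hj => by simp [hv G j (hG hj)]
    rwa [map_sub, sub_eq_zero] at this
  let := sigmaTopology d
  exact mem_closure_of_tendsto ht (Filter.Eventually.of_forall hvV)

end HopfSubalgebra
end DiscreteHopf

theorem mainTheorem8 {I : Type u} (d : I → ℕ) (hd : ∀ i, 0 < d i)
    (A : DiscreteHopf.DiscreteHopfStarAlgebra d) (R : (DiscreteHopf.M₂ d)ˣ)
    (hR : DiscreteHopf.IsRMatrix A R) :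
    ∃ B : NonUnitalStarSubalgebra ℂ (DiscreteHopf.M d),
      DiscreteHopf.IsDiscreteHopfStarSubalgebra A B ∧
      DiscreteHopf.SitsNondegenerately B ∧
      (R : DiscreteHopf.M₂ d) ∈
        DiscreteHopf.multipliers (DiscreteHopf.tensor B.toSubmodule B.toSubmodule) ∧
      DiscreteHopf.IsHopfStarSubalgebra A (DiscreteHopf.sliceSpan (R : DiscreteHopf.M₂ d)) ∧
      (DiscreteHopf.sliceSpan (R : DiscreteHopf.M₂ d) : Set (DiscreteHopf.M d)) ⊆
        DiscreteHopf.multipliers B.toSubmodule ∧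
      DiscreteHopf.multipliers B.toSubmodule ⊆
        @closure (DiscreteHopf.M d) (DiscreteHopf.sigmaTopology d)
          (DiscreteHopf.sliceSpan (R : DiscreteHopf.M₂ d) : Set (DiscreteHopf.M d)) := by
  open DiscreteHopf in
  have hU := isHopfStarSubalgebra_sliceSpan hR
  have hN := hU.isBlockClosed
  exact ⟨finitePart hU.closure, isDiscreteHopfStarSubalgebra_finitePart hU,
    sitsNondegenerately_finitePart hN,
    mem_multipliers_of_coeff_mem hN
      (fun i a a' => hU.mem_closure (leftLeg_le_sliceSpan hR (coeff₂_mem_leftLeg _ i a a')))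
      (fun j b b' => hU.mem_closure (rightLeg_le_sliceSpan hR (coeff₁_mem_rightLeg _ j b b'))),
    hU, fun x hx => (mem_multipliers_finitePart_iff hN).mpr (hU.mem_closure hx),
    fun x hx => mem_closure_sigmaTopology ((mem_multipliers_finitePart_iff hN).mp hx)⟩
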